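/- Let $q$ be a prime power and let $n\ge 4$, $1\le d\le n-1$ and $s$ be integers with $\gcd(s,n)=1$. Let $\mathcal L$ be the $\mathbb F_q$-algebra of $q$-polynomials $\sum_{i=0}^{n-1}c_ix^{q^i}$ over $\mathbb F_{q^n}$ modulo $x^{q^n}-x$, identified with $\mathrm{End}_{\mathbb F_q}(\mathbb F_{q^n})$; exponents $j$ in $x^{q^j}$ are integers read modulo $n$. Let $f^\top$ denote the adjoint of $f$ with respect to $(x,y)\mapsto \mathrm{Tr}_{q^n/q}(xy)$, and $V^\top=\{f^\top: f\in V\}$. Let $S_n(q)=\{f\in\mathcal L: f^\top=f\}$ and $A_n(q)=\{f\in\mathcal L:\mathrm{Tr}_{q^n/q}(f(x)x)=0\ \text{for all }x\}$, and let $X_n$ be one of these two spaces. A $d$-code is a set of maps any two distinct elements of which have a difference of rank at least $d$; a maximum additive $d$-code in $X_n$ is an additive subgroup of $X_n$ that is a $d$-code and has the largest size among all such subgroups. Put $$\mathcal G_{n,k,s}=\Big\{\sum_{i=0}^{k-1}a_ix^{q^{si}} : a_i\in\mathbb F_{q^n}\Big\},$$ $$\mathcal S_{n,d,s}=\Big\{b_0x+\sum_{i=1}^{(n-d)/2}\big(b_ix^{q^{si}}+(b_ix)^{q^{s(n-i)}}\big)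 : b_i\in\mathbb F_{q^n}\Big\}\quad(n-d\text{ even}),$$ $$\mathcal A_{n,d,s}=\Big\{\sum_{i=d/2}^{(n-1)/2}\big(b_ix^{q^{si}}-(b_ix)^{q^{s(n-i)}}\big) : b_i\in\mathbb F_{q^n}\Big\}\quad(n\text{ odd},\ d\text{ even}).$$ For a field automorphism $\rho$ of $\mathbb F_{q^n}$ let $f^\rho$ be obtained by applying $\rho$ to the coefficients of $f$. For $\mathcal C,\mathcal C'\subseteq\mathcal L$ write $\mathcal C\simeq\mathcal C'$ if $\mathcal C'=\{g_1\circ f^\rho\circ g_2+h: f\in\mathcal C\}$ for some invertible $g_1,g_2\in\mathcal L$, some $\rho$ and some $h\in\mathcal L$. For $\mathcal C,\mathcal C'\subseteq X_n$ write $\mathcal C\cong\mathcal C'$ if $\mathcal C'=\{a\,g\circ f^\rho\circ g^\top+r_0: f\in\mathcal C\}$ for some $a\in\mathbb F_q^*$, some invertible $g\in\mathcal L$, some $\rho$ and some $r_0\in X_n$. (i) Suppose that $n-d$ is even, and let $\mathcal D$ be a maximum additive $d$-code in $S_n(q)$. Then $\mathcal S_{n,d,s}\cong\mathcal D$ if and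 only if there is a unique $\mathbb F_q$-subspace $V$ of $\mathcal L$ such that (a) $V\simeq\mathcal G'$, where $\mathcal G'=\mathcal G_{n,n-d+1,s}\circ x^{q^{s(n+d)/2}}$; (b) $V=V^\top$; (c) $V\cap S_n(q)=\mathcal D$. (ii) Suppose that $n$ is odd, $d$ is even and $d\ne 2$, and let $\mathcal D$ be a maximum additive $d$-code in $A_n(q)$. Then $\mathcal A_{n,d,s}\cong\mathcal D$ if and only if there is a unique $\mathbb F_q$-subspace $V$ of $\mathcal L$ such that (a) $V\simeq\mathcal G'$, where $\mathcal G'=\mathcal G_{n,n-d+1,s}\circ x^{q^{sd/2}}$; (b) $V=V^\top$; (c) $V\cap A_n(q)=\mathcal D$. -/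

import Mathlib

noncomputable section

namespace RankCodes

/-! Throughout, `F` is the finite field with `q` elements and `K` is an extension of `F` of degree
`n`, i.e. the field with `q ^ n` elements.  A `q`-polynomial modulo `x ^ (q ^ n) - x` is the
`F`-linear endomorphism of `K` that it induces. -/

variable (F K : Type*) [Field F] [Fintype F] [Field K] [Algebra F K] [FiniteDimensional F K]

/-- The automorphism `x ↦ x ^ q` of `K` over `F`. -/
def frob : K ≃ₐ[F] K := FiniteField.frobeniusAlgEquivOfAlgebraic F K

theorem frob_apply (x : K) : frob F K x = x ^ Fintype.card F := rfl

/-- The map `x ↦ x ^ (q ^ j)`; the exponent `j` is an integer, and it matters only modulo `n`. -/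
def powMap (j : ℤ) : Module.End F K := ((frob F K) ^ j).toLinearMap

variable {F K}

/-- The map `x ↦ c * x ^ (q ^ j)`. -/
def qMonomial (c : K) (j : ℤ) : Module.End F K := LinearMap.mulLeft F c ∘ₗ powMap F K j

/-- The map `x ↦ (c * x) ^ (q ^ j)`. -/
def qMonomial' (c : K) (j : ℤ) : Module.End F K := powMap F K j ∘ₗ LinearMap.mulLeft F c

/-- Every field automorphism of `K` commutes with the automorphisms of `K` over `F`. -/
theorem ringEquiv_comm (ρ : K ≃+* K) (φ : K ≃ₐ[F] K) (y : K) : ρ (φ y) = φ (ρ y) := by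
  have : Finite K := Module.finite_of_finite F
  obtain ⟨i, rfl⟩ := (FiniteField.bijective_frobeniusAlgEquivOfAlgebraic_pow F K).2 φ
  simp [AlgEquiv.coe_pow, FiniteField.coe_frobeniusAlgEquivOfAlgebraic_iterate]

/-- Every field automorphism of `K` maps `F` into itself. -/
theorem exists_algebraMap_eq (ρ : K ≃+* K) (c : F) :
    ∃ c' : F, algebraMap F K c' = ρ (algebraMap F K c) := by
  have : Finite K := Module.finite_of_finite F
  have h : ρ (algebraMap F K c) ∈ Set.range (algebraMap F K) := by
    rw [IsGalois.mem_range_algebraMap_iff_fixed]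
    intro φ
    rw [← ringEquiv_comm, AlgEquiv.commutes]
  exact h

/-- `f ↦ f^ρ`, the action of a field automorphism on the coefficients of `q`-polynomials:
`∑ aᵢ x ^ (q ^ i)` goes to `∑ ρ aᵢ x ^ (q ^ i)` (see `twist_qMonomial`).  As a map, `f^ρ` is
`ρ ∘ f ∘ ρ⁻¹`. -/
def twist (ρ : K ≃+* K) (f : Module.End F K) : Module.End F K where
  toFun x := ρ (f (ρ.symm x))
  map_add' x y := by simp
  map_smul' c x := by
    obtain ⟨c', hc'⟩ := exists_algebraMap_eq ρ.symm c
    have hc : ρ (algebraMap F K c') = algebraMap F K c := by rw [hc']; simp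
    rw [Algebra.smul_def, map_mul, ← hc', ← Algebra.smul_def, map_smul, Algebra.smul_def, map_mul,
      hc, ← Algebra.smul_def]
    rfl

theorem twist_add (ρ : K ≃+* K) (f g : Module.End F K) :
    twist ρ (f + g) = twist ρ f + twist ρ g := by
  ext x; simp [twist]

theorem twist_qMonomial (ρ : K ≃+* K) (c : K) (j : ℤ) :
    twist ρ (qMonomial c j : Module.End F K) = qMonomial (ρ c) j := by
  ext x
  simp [twist, qMonomial, powMap, ringEquiv_comm]

/-- The trace form `(x, y) ↦ Tr(x * y)` is nondegenerate. -/
theorem traceForm_nondeg : (Algebra.traceForm F K).Nondegenerate :=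
  traceForm_nondegenerate F K

/-- `f^⊤`, the adjoint of `f` with respect to the trace form: `Tr(f^⊤(x) * y) = Tr(x * f(y))`. -/
def adj (f : Module.End F K) : Module.End F K :=
  LinearMap.BilinForm.leftAdjointOfNondegenerate (Algebra.traceForm F K) traceForm_nondeg f

theorem trace_adj (f : Module.End F K) (x y : K) :
    Algebra.trace F K (adj f x * y) = Algebra.trace F K (x * f y) :=
  LinearMap.BilinForm.isAdjointPairLeftAdjointOfNondegenerate _ traceForm_nondeg f x y

theorem adj_unique (f g : Module.End F K)
    (h : ∀ x y, Algebra.trace F K (g x * y) = Algebra.trace F K (x * f y)) : g = adj f :=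
  (LinearMap.BilinForm.isAdjointPair_iff_eq_of_nondegenerate _ traceForm_nondeg g f).1 h

/-- The adjoint of `c * x ^ (q ^ j)` is `(c * x) ^ (q ^ (- j))`. -/
theorem adj_qMonomial (c : K) (j : ℤ) :
    adj (qMonomial c j : Module.End F K) = qMonomial' c (-j) := by
  refine (adj_unique _ _ fun x y => ?_).symm
  rw [← Algebra.trace_eq_of_algEquiv (frob F K ^ j)]
  congr 1
  have h : (frob F K ^ j) ((frob F K ^ (-j)) (c * x)) = c * x := by
    rw [← AlgEquiv.mul_apply, ← zpow_add]; simp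
  simp only [qMonomial', qMonomial, powMap, LinearMap.comp_apply, AlgEquiv.toLinearMap_apply,
    LinearMap.mulLeft_apply, map_mul (frob F K ^ j)] at h ⊢
  rw [h]
  ring

variable (F K) in
/-- `S_n(q)`: the self-adjoint maps, i.e. those `f` for which the bilinear form
`Tr(f(x) * y)` is symmetric. -/
def symSpace : Set (Module.End F K) := {f | adj f = f}

variable (F K) in
/-- `A_n(q)`: the maps `f` for which the bilinear form `Tr(f(x) * y)` is alternating. -/
def altSpace : Set (Module.End F K) := {f | ∀ x, Algebra.trace F K (f x * x) = 0}

/-- The rank of an `F`-linear endomorphism of `K`. -/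
def rk (f : Module.End F K) : ℕ := Module.finrank F (LinearMap.range f)

/-- `d`-codes: distinct elements are at rank distance at least `d`. -/
def IsCode (d : ℕ) (C : Set (Module.End F K)) : Prop :=
  ∀ f ∈ C, ∀ g ∈ C, f ≠ g → d ≤ rk (f - g)

/-- `D` is an additive `d`-code in `X` and has the largest size among the additive `d`-codes
in `X`. -/
def IsMaximumCode (X : Set (Module.End F K)) (d : ℕ) (D : AddSubgroup (Module.End F K)) : Prop :=
  (D : Set (Module.End F K)) ⊆ X ∧ IsCode d (D : Set (Module.End F K)) ∧
    ∀ C : AddSubgroup (Module.End F K), (C : Set (Module.End F K)) ⊆ X →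
      IsCode d (C : Set (Module.End F K)) → Nat.card C ≤ Nat.card D

/-- `C₁ ≃ C₂`: `C₂ = {g₁ ∘ f^ρ ∘ g₂ + h : f ∈ C₁}` with `g₁, g₂` permutation `q`-polynomials
and `ρ` a field automorphism.  (An automorphism of `F` acts on coefficients in `K` through an
extension to `K`; another choice of the extension changes only `g₁` and `g₂`.) -/
def Equivalent (C₁ C₂ : Set (Module.End F K)) : Prop :=
  ∃ (g₁ g₂ : K ≃ₗ[F] K) (ρ : K ≃+* K) (h : Module.End F K),
    C₂ = (fun f => g₁.toLinearMap ∘ₗ twist ρ f ∘ₗ g₂.toLinearMap + h) '' C₁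

/-- `C₁ ≅ C₂` in the ambient space `X`: `C₂ = {a g ∘ f^ρ ∘ g^⊤ + r₀ : f ∈ C₁}` with
`a` a nonzero element of `F`, `g` a permutation `q`-polynomial, `ρ` a field automorphism
and `r₀` in `X`. -/
def EquivalentIn (X C₁ C₂ : Set (Module.End F K)) : Prop :=
  ∃ (a : F) (g : K ≃ₗ[F] K) (ρ : K ≃+* K) (r₀ : Module.End F K), a ≠ 0 ∧ r₀ ∈ X ∧
    C₂ = (fun f => a • (g.toLinearMap ∘ₗ twist ρ f ∘ₗ adj g.toLinearMap) + r₀) '' C₁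

variable (F K)

/-- The generalized Gabidulin code `G_{n,k,s}`: the maps `∑_{i < k} aᵢ x ^ (q ^ (s i))`. -/
def gabidulin (k : ℕ) (s : ℤ) : Set (Module.End F K) :=
  {f | ∃ a : ℕ → K, f = ∑ i ∈ Finset.range k, qMonomial (a i) (s * i)}

/-- `G_{n,k,s} ∘ x ^ (q ^ t)`. -/
def gabidulinShift (k : ℕ) (s t : ℤ) : Set (Module.End F K) :=
  (fun f => f ∘ₗ powMap F K t) '' gabidulin F K k s

/-- `S_{n,d,s}`: the maps
`b₀ x + ∑_{i=1}^{(n-d)/2} (bᵢ x ^ (q ^ (s i)) + (bᵢ x) ^ (q ^ (s (n - i))))`. -/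
def symCode (n d : ℕ) (s : ℤ) : Set (Module.End F K) :=
  {f | ∃ b : ℕ → K, f = LinearMap.mulLeft F (b 0) +
    ∑ i ∈ Finset.Icc 1 ((n - d) / 2),
      (qMonomial (b i) (s * i) + qMonomial' (b i) (s * ((n : ℤ) - i)))}

/-- `A_{n,d,s}`: the maps
`∑_{i=d/2}^{(n-1)/2} (bᵢ x ^ (q ^ (s i)) - (bᵢ x) ^ (q ^ (s (n - i))))`. -/
def altCode (n d : ℕ) (s : ℤ) : Set (Module.End F K) :=
  {f | ∃ b : ℕ → K, f = ∑ i ∈ Finset.Icc (d / 2) ((n - 1) / 2),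
      (qMonomial (b i) (s * i) - qMonomial' (b i) (s * ((n : ℤ) - i)))}

end RankCodes

end

/-!
Every `F`-linear map `f` of `K` is uniquely `∑ c_τ τ` with `τ` in the Galois group `Γ` and `c_τ` in
`K` (`coef`).  With `σ = frob ^ s`, a generator of `Γ`, the shifted Gabidulin codes are the spaces
`supportedOn J` of the maps whose coefficients vanish outside a cyclic interval `J = J⁻¹` of powers
of `σ` (`gabidulinShift_eq`), and the standard codes are the self-adjoint, respectively alternating,
maps `C` in `supportedOn J`.

*A code equivalent to `C` determines `V`.*  A code equivalent to `C` is `g ∘ C ∘ g^⊤`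
(`equivalentIn_iff`), and `V = g ∘ supportedOn J ∘ g^⊤` has the three properties.  For uniqueness it
is enough that `h₁ ∘ C ∘ h₂ ⊆ supportedOn J` implies `h₁ ∘ supportedOn J ∘ h₂ ⊆ supportedOn J`.
Write `u` for the coefficients of `h₁` and `y r` for the rows of the Dickson matrix of `h₂`.  By the
independence of automorphisms, the hypothesis says `u i * y r (i t) ± u (i t) * y r i = 0` for
`t ∈ J`, `r ∉ J`, and the conclusion that both summands vanish.  In the self-adjoint case `C`
contains the multiplications, which gives `u i * y r i = 0`, and this suffices
(`sandwich_supportedOn_le_of_sym`).  In the alternating case, if `u i` and `u (i t)` were both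
nonzero, the rows `y r` with `r ∉ J` would lie in a space of dimension less than the number of these
rows, which are linearly independent; this uses `d ≠ 2` (`sandwich_supportedOn_le_of_alt`,
`exists_notMem_interval`).

*A space `V` determines the equivalence.*  Let `V = g₁ ∘ supportedOn J ∘ g₂` be closed under
adjoints.  Then `g₁⁻¹ ∘ g₂^⊤` normalizes the left idealizer of `supportedOn J`, which is `K`, hence
is of the form `x ↦ c * τ x`, and `V = g₁ ∘ supportedOn (J τ⁻¹) ∘ g₁^⊤` with `τ ^ 2 = 1`
(`exists_map_sandwich_eq`).  If `τ = 1`, then `V` cuts out a code equivalent to `C`.  The case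
`τ ≠ 1` occurs only for `n` even; then `V` contains fewer self-adjoint maps than `supportedOn J`
(`ncard_translate_lt`), against the maximality of the code, because `C` itself is a `d`-code
(`le_rk_of_mem_supportedOn_interval`).  For `d = 1` the space `supportedOn J` contains all maps, and
a maximum code consists of all self-adjoint maps.
-/

noncomputable section

namespace RankCodes

variable {F K : Type*} [Field F] [Fintype F] [Field K] [Algebra F K] [FiniteDimensional F K]

set_option linter.unusedSectionVars false

/-! ### Coefficients with respect to the Galois group -/

/-- The map `x ↦ c * τ x`, for an automorphism `τ` of `K` over `F`. -/
def mono (c : K) (τ : Gal(K/F)) : Module.End F K := LinearMap.mulLeft F c ∘ₗ τ.toLinearMap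

@[simp]
theorem mono_apply (c : K) (τ : Gal(K/F)) (x : K) : mono c τ x = c * τ x := rfl

theorem mono_comp_mono (a b : K) (τ υ : Gal(K/F)) :
    mono a τ ∘ₗ mono b υ = mono (a * τ b) (τ * υ) := by
  ext x; simp [mul_assoc]

theorem mono_zero (τ : Gal(K/F)) : mono (0 : K) τ = 0 := by
  ext x; simp

/-- The map `∑ τ, a τ * τ x` with coefficients `a`. -/
def ofCoef : (Gal(K/F) → K) →ₗ[F] Module.End F K where
  toFun a := ∑ τ, mono (a τ) τ
  map_add' a b := by
    ext x; simp [add_mul, Finset.sum_add_distrib]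
  map_smul' c a := by
    ext x; simp [Finset.smul_sum]

theorem ofCoef_eq_sum (a : Gal(K/F) → K) : ofCoef a = ∑ τ, mono (a τ) τ := rfl

theorem ofCoef_apply (a : Gal(K/F) → K) (x : K) : ofCoef a x = ∑ τ, a τ * τ x := by
  simp [ofCoef_eq_sum]

/-- Distinct automorphisms of `K` are linearly independent over `K`. -/
theorem ofCoef_injective : Function.Injective (ofCoef : (Gal(K/F) → K) →ₗ[F] Module.End F K) := by
  rw [injective_iff_map_eq_zero]
  intro a ha
  have hli : LinearIndependent K (fun τ : Gal(K/F) => (τ : K → K)) :=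
    (linearIndependent_monoidHom K K).comp
      (fun τ : Gal(K/F) => ((τ : K →+* K) : K →* K)) (fun τ τ' h => by
        ext x; exact DFunLike.congr_fun h x)
  rw [Fintype.linearIndependent_iff] at hli
  funext τ
  refine hli a ?_ τ
  funext x
  have := LinearMap.congr_fun ha x
  rw [ofCoef_apply] at this
  simpa using this

/-- Every `F`-linear endomorphism of `K` has unique coefficients. -/
def coefEquiv : (Gal(K/F) → K) ≃ₗ[F] Module.End F K :=
  have : Finite K := Module.finite_of_finite F
  LinearEquiv.ofInjectiveOfFinrankEq ofCoef ofCoef_injective (by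
    rw [Module.finrank_pi_fintype, Module.finrank_linearMap]
    simp [← Nat.card_eq_fintype_card, IsGalois.card_aut_eq_finrank])

/-- The coefficients of an endomorphism: `f x = ∑ τ, coef f τ * τ x`. -/
def coef : Module.End F K ≃ₗ[F] (Gal(K/F) → K) := coefEquiv.symm

@[simp]
theorem ofCoef_coef (f : Module.End F K) : ofCoef (coef f) = f :=
  coefEquiv.apply_symm_apply f

@[simp]
theorem coef_ofCoef (a : Gal(K/F) → K) : coef (ofCoef a) = a :=
  coefEquiv.symm_apply_apply a

theorem eq_of_coef_eq {f g : Module.End F K} (h : ∀ τ, coef f τ = coef g τ) : f = g :=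
  coef.injective (funext h)

theorem apply_eq_sum_coef (f : Module.End F K) (x : K) : f x = ∑ τ, coef f τ * τ x := by
  rw [← ofCoef_apply, ofCoef_coef]

open Classical in
theorem coef_mono (c : K) (τ υ : Gal(K/F)) : coef (mono c τ) υ = if υ = τ then c else 0 := by
  have : mono c τ = ofCoef (fun υ => if υ = τ then c else 0) := by
    ext x; simp [ofCoef_apply]
  rw [this, coef_ofCoef]

theorem coef_mono_self (c : K) (τ : Gal(K/F)) : coef (mono c τ) τ = c := by
  simp [coef_mono]

theorem coef_mono_of_ne (c : K) {τ υ : Gal(K/F)} (h : υ ≠ τ) : coef (mono c τ) υ = 0 := by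
  simp [coef_mono, h]

theorem coef_mono_comp (c : K) (τ : Gal(K/F)) (g : Module.End F K) (υ : Gal(K/F)) :
    coef (mono c τ ∘ₗ g) υ = c * τ (coef g (τ⁻¹ * υ)) := by
  have : mono c τ ∘ₗ g = ofCoef (fun υ => c * τ (coef g (τ⁻¹ * υ))) := by
    ext x
    rw [ofCoef_apply, LinearMap.comp_apply, mono_apply, apply_eq_sum_coef g x, map_sum,
      Finset.mul_sum]
    refine Fintype.sum_equiv (Equiv.mulLeft τ) _ _ fun υ => ?_
    simp [mul_assoc]
  rw [this, coef_ofCoef]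

/-- The product rule of the skew group algebra of the Galois group. -/
theorem coef_comp (f g : Module.End F K) (υ : Gal(K/F)) :
    coef (f ∘ₗ g) υ = ∑ τ, coef f τ * τ (coef g (τ⁻¹ * υ)) := by
  have : f ∘ₗ g = ∑ τ, mono (coef f τ) τ ∘ₗ g := by
    ext x; simp [LinearMap.sum_apply, apply_eq_sum_coef f]
  rw [this, map_sum, Finset.sum_apply]
  simp only [coef_mono_comp]

theorem coef_comp_mono (f : Module.End F K) (c : K) (τ υ : Gal(K/F)) :
    coef (f ∘ₗ mono c τ) υ = coef f (υ * τ⁻¹) * (υ * τ⁻¹) c := by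
  classical
  rw [coef_comp, Finset.sum_eq_single (υ * τ⁻¹)]
  · simp [coef_mono]
  · intro i _ hi
    rw [coef_mono_of_ne, map_zero, mul_zero]
    rintro h
    exact hi (by rw [← h]; group)
  · simp

theorem trace_algEquiv (τ : Gal(K/F)) (x : K) :
    Algebra.trace F K (τ x) = Algebra.trace F K x :=
  Algebra.trace_eq_of_algEquiv τ x

theorem coef_adj (f : Module.End F K) (τ : Gal(K/F)) : coef (adj f) τ = τ (coef f τ⁻¹) := by
  have : adj f = ofCoef (fun τ => τ (coef f τ⁻¹)) := by
    refine (adj_unique _ _ fun x y => ?_).symm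
    rw [ofCoef_apply, apply_eq_sum_coef f y, Finset.sum_mul, Finset.mul_sum, map_sum, map_sum]
    refine Fintype.sum_equiv (Equiv.inv _) _ _ fun τ => ?_
    rw [← trace_algEquiv τ⁻¹]
    congr 1
    simp only [map_mul, ← AlgEquiv.mul_apply, inv_mul_cancel, Equiv.inv_apply, AlgEquiv.one_apply]
    ring
  rw [this, coef_ofCoef]

theorem adj_adj (f : Module.End F K) : adj (adj f) = f := by
  refine eq_of_coef_eq fun τ => ?_
  rw [coef_adj, coef_adj, inv_inv, ← AlgEquiv.mul_apply, mul_inv_cancel, AlgEquiv.one_apply]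

theorem adj_comp (f g : Module.End F K) : adj (f ∘ₗ g) = adj g ∘ₗ adj f := by
  refine (adj_unique _ _ fun x y => ?_).symm
  rw [LinearMap.comp_apply, trace_adj, trace_adj, LinearMap.comp_apply]

theorem adj_id : adj (LinearMap.id : Module.End F K) = LinearMap.id :=
  (adj_unique _ _ fun _ _ => rfl).symm

theorem adj_add (f g : Module.End F K) : adj (f + g) = adj f + adj g := by
  refine eq_of_coef_eq fun τ => ?_
  simp [coef_adj]

theorem adj_smul (c : F) (f : Module.End F K) : adj (c • f) = c • adj f := by
  refine eq_of_coef_eq fun τ => ?_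
  simp [coef_adj]

theorem adj_mono (c : K) (τ : Gal(K/F)) : adj (mono c τ) = mono (τ⁻¹ c) τ⁻¹ := by
  classical
  refine eq_of_coef_eq fun υ => ?_
  rw [coef_adj, coef_mono, coef_mono]
  by_cases h : υ = τ⁻¹
  · simp [h]
  · rw [if_neg h, if_neg (by rwa [inv_eq_iff_eq_inv]), map_zero]

theorem coef_twist (ρ : K ≃+* K) (f : Module.End F K) (τ : Gal(K/F)) :
    coef (twist ρ f) τ = ρ (coef f τ) := by
  have : twist ρ f = ofCoef (fun τ => ρ (coef f τ)) := by
    ext x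
    change ρ (f (ρ.symm x)) = _
    rw [apply_eq_sum_coef f, ofCoef_apply, map_sum]
    refine Finset.sum_congr rfl fun τ _ => ?_
    rw [map_mul, ringEquiv_comm, RingEquiv.apply_symm_apply]
  rw [this, coef_ofCoef]

/-- The adjoint of a permutation. -/
def adjEquiv (g : K ≃ₗ[F] K) : K ≃ₗ[F] K :=
  LinearEquiv.ofLinearMap (adj g.toLinearMap) (adj g.symm.toLinearMap)
    (by rw [← adj_comp, LinearEquiv.symm_comp, adj_id])
    (by rw [← adj_comp, LinearEquiv.comp_symm, adj_id])

@[simp]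
theorem adjEquiv_toLinearMap (g : K ≃ₗ[F] K) :
    (adjEquiv g).toLinearMap = adj g.toLinearMap := rfl

theorem adjEquiv_adjEquiv (g : K ≃ₗ[F] K) : adjEquiv (adjEquiv g) = g := by
  apply LinearEquiv.toLinearMap_injective
  simp [adj_adj]

/-- The operation `f ↦ g₁ ∘ f ∘ g₂`. -/
def sandwich (g₁ g₂ : K ≃ₗ[F] K) : Module.End F K ≃ₗ[F] Module.End F K :=
  g₂.symm.arrowCongr g₁

theorem sandwich_apply (g₁ g₂ : K ≃ₗ[F] K) (f : Module.End F K) :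
    sandwich g₁ g₂ f = g₁.toLinearMap ∘ₗ f ∘ₗ g₂.toLinearMap := rfl

theorem sandwich_sandwich (g₁ g₂ h₁ h₂ : K ≃ₗ[F] K) (f : Module.End F K) :
    sandwich g₁ g₂ (sandwich h₁ h₂ f) = sandwich (h₁ ≪≫ₗ g₁) (g₂ ≪≫ₗ h₂) f := rfl

theorem sandwich_symm (g₁ g₂ : K ≃ₗ[F] K) :
    (sandwich g₁ g₂).symm = sandwich g₁.symm g₂.symm := rfl

theorem adj_sandwich (g₁ g₂ : K ≃ₗ[F] K) (f : Module.End F K) :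
    adj (sandwich g₁ g₂ f) = sandwich (adjEquiv g₂) (adjEquiv g₁) (adj f) := by
  simp only [sandwich_apply, adj_comp, adjEquiv_toLinearMap, LinearMap.comp_assoc]

/-! ### Maps with prescribed support -/

/-- The maps all of whose coefficients outside `J` vanish. -/
def supportedOn (J : Set Gal(K/F)) : Submodule F (Module.End F K) where
  carrier := {f | ∀ τ ∉ J, coef f τ = 0}
  add_mem' {f g} hf hg τ hτ := by simp [hf τ hτ, hg τ hτ]
  zero_mem' τ _ := by simp
  smul_mem' c f hf τ hτ := by simp [hf τ hτ]

theorem mem_supportedOn {J : Set Gal(K/F)} {f : Module.End F K} :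
    f ∈ supportedOn J ↔ ∀ τ ∉ J, coef f τ = 0 := Iff.rfl

theorem mono_mem_supportedOn {J : Set Gal(K/F)} {τ : Gal(K/F)} (c : K) (h : τ ∈ J) :
    mono c τ ∈ supportedOn J :=
  mem_supportedOn.2 fun _ hυ => coef_mono_of_ne c fun e => hυ (e ▸ h)

theorem supportedOn_le_iff {J : Set Gal(K/F)} {W : Submodule F (Module.End F K)} :
    supportedOn J ≤ W ↔ ∀ τ ∈ J, ∀ c : K, mono c τ ∈ W := by
  refine ⟨fun h τ hτ c => h (mono_mem_supportedOn c hτ), fun h f hf => ?_⟩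
  rw [← ofCoef_coef f, ofCoef_eq_sum]
  refine Submodule.sum_mem _ fun τ _ => ?_
  by_cases hτ : τ ∈ J
  · exact h τ hτ _
  · rw [mem_supportedOn.1 hf τ hτ, mono_zero]
    exact zero_mem _

theorem twist_mem_supportedOn {J : Set Gal(K/F)} (ρ : K ≃+* K) {f : Module.End F K}
    (hf : f ∈ supportedOn J) : twist ρ f ∈ supportedOn J := fun τ hτ => by
  rw [coef_twist, mem_supportedOn.1 hf τ hτ, map_zero]

theorem adj_mem_supportedOn {J : Set Gal(K/F)} {f : Module.End F K}
    (hf : f ∈ supportedOn J) : adj f ∈ supportedOn J⁻¹ := fun τ hτ => by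
  rw [coef_adj, mem_supportedOn.1 hf τ⁻¹ hτ, map_zero]

/-! ### A sandwich containing enough self-adjoint or alternating maps -/

/-- A finite extension of a finite field has commuting automorphisms. -/
theorem gal_mul_comm (τ υ : Gal(K/F)) : τ * υ = υ * τ := by
  ext x
  exact ringEquiv_comm (τ : K ≃+* K) υ x

/-- The entry in row `r` and column `k` of the Dickson matrix of `h`, indexed by the Galois group:
the coefficient of `r` in `k ∘ h`. -/
def dickson (h : Module.End F K) (r k : Gal(K/F)) : K := k (coef h (k⁻¹ * r))

theorem coef_comp_mono_comp (h₁ h₂ : Module.End F K) (b : K) (t r : Gal(K/F)) :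
    coef (h₁ ∘ₗ mono b t ∘ₗ h₂) r = ∑ i, coef h₁ i * dickson h₂ r (i * t) * i b := by
  rw [coef_comp]
  refine Finset.sum_congr rfl fun i _ => ?_
  rw [coef_mono_comp, dickson, map_mul, ← AlgEquiv.mul_apply, mul_inv_rev, mul_assoc t⁻¹]
  ring

/-- The coefficients of the adjoint `mono (t⁻¹ b) t⁻¹` of `mono b t` between two maps, written so
that `b` enters as in `coef_comp_mono_comp`. -/
theorem coef_comp_adj_mono_comp (h₁ h₂ : Module.End F K) (b : K) (t r : Gal(K/F)) :
    coef (h₁ ∘ₗ adj (mono b t) ∘ₗ h₂) r = ∑ i, coef h₁ (i * t) * dickson h₂ r i * i b := by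
  rw [adj_mono, coef_comp_mono_comp]
  refine (Fintype.sum_equiv (Equiv.mulRight t) _ _ fun i => ?_).symm
  simp

/-- The rows of the Dickson matrix of a permutation are linearly independent. -/
theorem eq_zero_of_sum_dickson (h : K ≃ₗ[F] K) (l : Gal(K/F) → K)
    (hl : ∀ k, ∑ r, l r * dickson h.toLinearMap r k = 0) : l = 0 := by
  -- the relation says that `h` annihilates the map with coefficients `τ (l τ⁻¹)`
  have h0 : h.toLinearMap ∘ₗ ofCoef (fun τ => τ (l τ⁻¹)) = 0 := by
    refine eq_of_coef_eq fun υ => ?_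
    have := congrArg υ (hl υ⁻¹)
    rw [map_sum, map_zero] at this
    rw [coef_comp, map_zero, Pi.zero_apply, ← this]
    refine Fintype.sum_equiv (Equiv.mulLeft υ⁻¹) _ _ fun τ => ?_
    simp only [coef_ofCoef, dickson, Equiv.coe_mulLeft, map_mul, ← AlgEquiv.mul_apply, inv_inv,
      mul_inv_cancel, mul_inv_cancel_left, AlgEquiv.one_apply, mul_inv_rev]
    rw [mul_comm]
  have h1 : ofCoef (fun τ => τ (l τ⁻¹)) = (0 : Module.End F K) := by
    ext x
    have := LinearMap.congr_fun h0 x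
    simpa using this
  have h2 := ofCoef_injective (h1.trans (map_zero _).symm)
  funext r
  have := congrFun h2 r⁻¹
  simpa using this

/-- A sufficient condition for `h₁ ∘ f ∘ h₂` to be supported on `J` whenever `f` is: the terms of
`coef_comp_mono_comp` outside `J` vanish one by one. -/
theorem sandwich_supportedOn_le {J : Set Gal(K/F)} (h₁ h₂ : K ≃ₗ[F] K)
    (h : ∀ r ∉ J, ∀ t ∈ J, ∀ i, coef h₁.toLinearMap i * dickson h₂.toLinearMap r (i * t) = 0) :
    ∀ f ∈ supportedOn J, sandwich h₁ h₂ f ∈ supportedOn J := by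
  have : supportedOn J ≤ (supportedOn J).comap (sandwich h₁ h₂).toLinearMap := by
    rw [supportedOn_le_iff]
    intro t ht c r hr
    simp only [LinearEquiv.coe_coe, sandwich_apply]
    rw [coef_comp_mono_comp]
    exact Finset.sum_eq_zero fun i _ => by rw [h r hr t ht i, zero_mul]
  exact this

theorem eq_zero_of_sum_mul_algEquiv {a : Gal(K/F) → K} (h : ∀ b : K, ∑ i, a i * i b = 0)
    (i : Gal(K/F)) : a i = 0 := by
  have : ofCoef a = ofCoef (0 : Gal(K/F) → K) := by
    ext x; rw [ofCoef_apply, h]; simp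
  exact congrFun (ofCoef_injective this) i

/-- If `h₁ ∘ f ∘ h₂` is supported on `J` for the multiplications `f` and for the self-adjoint maps
`f = mono b t + adj (mono b t)` with `t` in `J`, then it is for all `f` supported on `J`. -/
theorem sandwich_supportedOn_le_of_sym {J : Set Gal(K/F)} (h₁ h₂ : K ≃ₗ[F] K)
    (h1 : ∀ b, sandwich h₁ h₂ (mono b 1) ∈ supportedOn J)
    (hJ : ∀ t ∈ J, ∀ b, sandwich h₁ h₂ (mono b t + adj (mono b t)) ∈ supportedOn J) :
    ∀ f ∈ supportedOn J, sandwich h₁ h₂ f ∈ supportedOn J := by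
  refine sandwich_supportedOn_le h₁ h₂ fun r hr t ht i => ?_
  have hdiag : coef h₁.toLinearMap i * dickson h₂.toLinearMap r i = 0 := by
    refine eq_zero_of_sum_mul_algEquiv
      (a := fun i => coef h₁.toLinearMap i * dickson h₂.toLinearMap r i) (fun b => ?_) i
    have := h1 b r hr
    rw [sandwich_apply, coef_comp_mono_comp] at this
    simpa using this
  have hsum : coef h₁.toLinearMap i * dickson h₂.toLinearMap r (i * t) +
      coef h₁.toLinearMap (i * t) * dickson h₂.toLinearMap r i = 0 := by
    refine eq_zero_of_sum_mul_algEquiv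
      (a := fun i => coef h₁.toLinearMap i * dickson h₂.toLinearMap r (i * t) +
        coef h₁.toLinearMap (i * t) * dickson h₂.toLinearMap r i) (fun b => ?_) i
    have := hJ t ht b r hr
    rw [map_add, sandwich_apply, sandwich_apply, map_add, Pi.add_apply, coef_comp_mono_comp,
      coef_comp_adj_mono_comp, ← Finset.sum_add_distrib] at this
    simpa only [add_mul] using this
  rcases mul_eq_zero.1 hdiag with h | h
  · rw [h, zero_mul]
  · rwa [h, mul_zero, add_zero] at hsum

/-- If `h₁ ∘ f ∘ h₂` is supported on `J` for the alternating maps `f = mono b t - adj (mono b t)`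
with `t` in `J`, then it is for all `f` supported on `J`.  The hypothesis `hz` says
that the translate `t J` contains an element outside `J` other than `1`. -/
theorem sandwich_supportedOn_le_of_alt {J : Set Gal(K/F)} (h₁ h₂ : K ≃ₗ[F] K)
    (h1 : 1 ∉ J) (hz : ∀ t ∈ J, ∃ z ∉ J, z ≠ 1 ∧ t⁻¹ * z ∈ J)
    (hJ : ∀ t ∈ J, ∀ b, sandwich h₁ h₂ (mono b t - adj (mono b t)) ∈ supportedOn J) :
    ∀ f ∈ supportedOn J, sandwich h₁ h₂ f ∈ supportedOn J := by
  classical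
  set u := coef h₁.toLinearMap with hu
  set y := dickson h₂.toLinearMap with hy
  have hminor : ∀ r ∉ J, ∀ t ∈ J, ∀ i, u i * y r (i * t) = u (i * t) * y r i := by
    intro r hr t ht i
    refine sub_eq_zero.1 (eq_zero_of_sum_mul_algEquiv
      (a := fun i => u i * y r (i * t) - u (i * t) * y r i) (fun b => ?_) i)
    have := hJ t ht b r hr
    rw [map_sub, sandwich_apply, sandwich_apply, map_sub, Pi.sub_apply, coef_comp_mono_comp,
      coef_comp_adj_mono_comp, ← Finset.sum_sub_distrib] at this
    simpa only [sub_mul] using this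
  -- the support of `u` contains no two elements that differ by an element of `J`
  have hindep : ∀ i, ∀ t ∈ J, u i ≠ 0 → u (i * t) = 0 := by
    intro i t ht hi
    by_contra hit
    obtain ⟨z, hzJ, hz1, hzt⟩ := hz t ht
    -- `T` is the set of positions, relative to `i`, that determine a combination of rows
    let R : Finset Gal(K/F) := Finset.univ.filter (· ∉ J)
    let T : Finset Gal(K/F) := insert 1 (R.filter (fun c => t⁻¹ * c ∉ J))
    have hcard : T.card < R.card := by
      have h1R : (1 : Gal(K/F)) ∈ R := by simp [R, h1]
      have hsub : T ⊆ R.erase z := by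
        intro c hc
        rcases Finset.mem_insert.1 hc with rfl | hc
        · exact Finset.mem_erase.2 ⟨hz1.symm, h1R⟩
        · obtain ⟨hcR, hct⟩ := Finset.mem_filter.1 hc
          exact Finset.mem_erase.2 ⟨fun e => hct (e ▸ hzt), hcR⟩
      refine (Finset.card_le_card hsub).trans_lt (Finset.card_erase_lt_of_mem ?_)
      simp [R, hzJ]
    let L : (R → K) →ₗ[K] (T → K) :=
      { toFun := fun l c => ∑ r, l r * y r (i * c)
        map_add' := fun l l' => by
          funext c; simp [add_mul, Finset.sum_add_distrib]
        map_smul' := fun a l => by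
          funext c; simp [Finset.mul_sum, mul_assoc] }
    have hker : LinearMap.ker L ≠ ⊥ := LinearMap.ker_ne_bot_of_finrank_lt (by simpa using hcard)
    obtain ⟨l, hl, hl0⟩ := (Submodule.ne_bot_iff _).1 hker
    have hlT : ∀ c ∈ T, ∑ r, l r * y r (i * c) = 0 := fun c hc =>
      congrFun (LinearMap.mem_ker.1 hl) ⟨c, hc⟩
    have hcomb : ∀ i, ∀ t ∈ J, u i * ∑ r, l r * y r (i * t) = u (i * t) * ∑ r, l r * y r i := by
      intro i t ht
      rw [Finset.mul_sum, Finset.mul_sum]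
      refine Finset.sum_congr rfl fun r _ => ?_
      have := hminor r (Finset.mem_filter.1 r.2).2 t ht i
      linear_combination l r * this
    have hi0 : ∑ r, l r * y r i = 0 := by
      simpa using hlT 1 (by simp [T])
    have hit0 : ∑ r, l r * y r (i * t) = 0 := by
      have := hcomb i t ht
      rw [hi0, mul_zero] at this
      exact (mul_eq_zero.1 this).resolve_left hi
    have hall : ∀ c, ∑ r, l r * y r (i * c) = 0 := by
      intro c
      by_cases hc : c ∈ J
      · have := hcomb i c hc
        rw [hi0, mul_zero] at this
        exact (mul_eq_zero.1 this).resolve_left hi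
      by_cases hct : t⁻¹ * c ∈ J
      · have := hcomb (i * t) _ hct
        rw [hit0, mul_zero, mul_assoc, mul_inv_cancel_left] at this
        exact (mul_eq_zero.1 this).resolve_left hit
      · exact hlT c (by simp [T, R, hc, hct])
    apply hl0
    have := eq_zero_of_sum_dickson h₂ (fun r => if h : r ∈ R then l ⟨r, h⟩ else 0) (fun k => by
      have := hall (i⁻¹ * k)
      rw [mul_inv_cancel_left] at this
      rw [← Finset.sum_subset (Finset.subset_univ R) (fun r _ hr => by rw [dif_neg hr, zero_mul]),
        ← Finset.sum_attach, ← this]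
      exact Finset.sum_congr rfl fun r _ => by rw [dif_pos r.2])
    funext r
    simpa using congrFun this r
  refine sandwich_supportedOn_le h₁ h₂ fun r hr t ht i => ?_
  rw [← hu, ← hy]
  by_cases hi : u i = 0
  · rw [hi, zero_mul]
  · rw [hminor r hr t ht i, hindep i t ht hi, zero_mul]

/-! ### Self-adjoint sandwiches of a support space -/

/-- If no nontrivial translate of `J` is contained in `J`, then the left idealizer of
`supportedOn J` consists of the multiplications by elements of `K`. -/
theorem eq_mono_of_comp_mem_supportedOn {J : Set Gal(K/F)}
    (hstab : ∀ t, (∀ j ∈ J, t * j ∈ J) → t = 1) {φ : Module.End F K}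
    (hφ : ∀ f ∈ supportedOn J, φ ∘ₗ f ∈ supportedOn J) : φ = mono (coef φ 1) 1 := by
  refine eq_of_coef_eq fun τ => ?_
  by_cases hτ : τ = 1
  · rw [hτ, coef_mono_self]
  · rw [coef_mono_of_ne _ hτ]
    by_contra h
    refine hτ (hstab τ fun j hj => ?_)
    by_contra hn
    have := hφ _ (mono_mem_supportedOn 1 hj) _ hn
    rw [coef_comp_mono, mul_inv_cancel_right, map_one, mul_one] at this
    exact h this

/-- A permutation normalizing the field of multiplications is semilinear over `K`. -/
theorem exists_eq_mono_of_normalizes (u : K ≃ₗ[F] K)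
    (hu : ∀ a : K, ∃ c : K, u.toLinearMap ∘ₗ mono a 1 = mono c 1 ∘ₗ u.toLinearMap) :
    ∃ (c : K) (τ : Gal(K/F)), c ≠ 0 ∧ u.toLinearMap = mono c τ := by
  obtain ⟨τ, hτ⟩ : ∃ τ, coef u.toLinearMap τ ≠ 0 := by
    by_contra! h
    have h0 : u.toLinearMap = 0 := eq_of_coef_eq fun τ => by rw [h τ, map_zero, Pi.zero_apply]
    have := u.injective.eq_iff.1 ((LinearMap.congr_fun h0 1).trans (map_zero u).symm)
    exact one_ne_zero this
  refine ⟨_, τ, hτ, eq_of_coef_eq fun υ => ?_⟩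
  by_cases hυ : υ = τ
  · rw [hυ, coef_mono_self]
  · rw [coef_mono_of_ne _ hυ]
    by_contra h
    refine hυ (AlgEquiv.ext fun a => ?_)
    obtain ⟨c, hc⟩ := hu a
    -- both `υ a` and `τ a` equal the factor `c`
    have key : ∀ i, coef u.toLinearMap i ≠ 0 → i a = c := by
      intro i hi
      have := congrFun (congrArg coef hc) i
      rw [coef_comp_mono, coef_mono_comp] at this
      simp only [inv_one, mul_one, one_mul, AlgEquiv.one_apply] at this
      exact mul_left_cancel₀ hi (by rw [this, mul_comm])
    rw [key υ h, key τ hτ]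

theorem exists_comp_mono_eq_iff (J : Set Gal(K/F)) {c : K} (hc : c ≠ 0) (τ : Gal(K/F))
    (f : Module.End F K) :
    (∃ f' ∈ supportedOn J, f' ∘ₗ mono c τ⁻¹ = f) ↔ f ∈ supportedOn {υ | υ * τ ∈ J} := by
  constructor
  · rintro ⟨f', hf', rfl⟩ υ hυ
    rw [coef_comp_mono, inv_inv, mem_supportedOn.1 hf' _ hυ, zero_mul]
  · intro hf
    refine ⟨f ∘ₗ mono (τ c⁻¹) τ, fun υ hυ => ?_, ?_⟩
    · rw [coef_comp_mono, mem_supportedOn.1 hf _ (by simpa using hυ), zero_mul]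
    · rw [LinearMap.comp_assoc, mono_comp_mono, ← map_mul, inv_mul_cancel₀ hc, map_one,
        mul_inv_cancel]
      ext x
      simp

/-- A sandwich `g₁ ∘ supportedOn J ∘ g₂` closed under adjoints has the form
`g₁ ∘ supportedOn J' ∘ adj g₁` with `J'` a translate of `J` by an involution or `1`:
`g₁⁻¹ ∘ adj g₂` normalizes the idealizer of `supportedOn J`, so it is semilinear over `K`. -/
theorem exists_map_sandwich_eq {J : Set Gal(K/F)} (hinv : J⁻¹ = J)
    (hstab : ∀ t, (∀ j ∈ J, t * j ∈ J) → t = 1) (g₁ g₂ : K ≃ₗ[F] K)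
    (hadj : ∀ f ∈ (supportedOn J).map (sandwich g₁ g₂).toLinearMap,
      adj f ∈ (supportedOn J).map (sandwich g₁ g₂).toLinearMap) :
    ∃ τ : Gal(K/F), τ * τ = 1 ∧ (supportedOn J).map (sandwich g₁ g₂).toLinearMap =
      (supportedOn {υ | υ * τ ∈ J}).map (sandwich g₁ (adjEquiv g₁)).toLinearMap := by
  set u : K ≃ₗ[F] K := adjEquiv g₂ ≪≫ₗ g₁.symm with hu
  set v : K ≃ₗ[F] K := g₂.symm ≪≫ₗ adjEquiv g₁ with hv
  have hmem : ∀ f ∈ supportedOn J, sandwich u v f ∈ supportedOn J := by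
    intro f hf
    have hf' : adj f ∈ supportedOn J := hinv ▸ adj_mem_supportedOn hf
    obtain ⟨f₁, hf₁, h⟩ := hadj _ (Submodule.mem_map_of_mem hf')
    simp only [LinearEquiv.coe_coe, adj_sandwich, adj_adj] at h
    have : sandwich u v f = f₁ := by
      rw [hu, hv, ← sandwich_sandwich, ← h, ← sandwich_symm, LinearEquiv.symm_apply_apply]
    rwa [this]
  have hmap : (supportedOn J).map (sandwich u v).toLinearMap = supportedOn J := by
    refine Submodule.eq_of_le_of_finrank_eq ?_ (LinearEquiv.finrank_map_eq _ _)
    rintro _ ⟨f, hf, rfl⟩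
    exact hmem f hf
  obtain ⟨c, τ, hc, huτ⟩ := exists_eq_mono_of_normalizes u fun a => by
    have := eq_mono_of_comp_mem_supportedOn hstab
      (φ := u.toLinearMap ∘ₗ mono a 1 ∘ₗ u.symm.toLinearMap) (fun f hf => by
        rw [← hmap] at hf
        obtain ⟨f', hf', rfl⟩ := hf
        have h1 : mono a 1 ∘ₗ f' ∈ supportedOn J := fun υ hυ => by
          rw [coef_mono_comp, inv_one, one_mul, mem_supportedOn.1 hf' υ hυ, map_zero, mul_zero]
        convert hmem _ h1 using 1
        ext x
        simp [sandwich_apply])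
    refine ⟨coef (u.toLinearMap ∘ₗ mono a 1 ∘ₗ u.symm.toLinearMap) 1, ?_⟩
    rw [← this]
    ext x
    simp
  have hg₂ : g₂.toLinearMap = mono (τ⁻¹ c) τ⁻¹ ∘ₗ adj g₁.toLinearMap := by
    rw [← adj_mono, ← huτ, ← adj_comp, hu]
    have : g₁.toLinearMap ∘ₗ (adjEquiv g₂ ≪≫ₗ g₁.symm).toLinearMap = adj g₂.toLinearMap := by
      rw [← adjEquiv_toLinearMap]
      ext x
      exact g₁.apply_symm_apply _
    rw [this, adj_adj]
  have hV : (supportedOn J).map (sandwich g₁ g₂).toLinearMap =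
      (supportedOn {υ | υ * τ ∈ J}).map (sandwich g₁ (adjEquiv g₁)).toLinearMap := by
    ext f
    simp only [Submodule.mem_map, LinearEquiv.coe_coe]
    have hs : ∀ f', sandwich g₁ g₂ f' = sandwich g₁ (adjEquiv g₁) (f' ∘ₗ mono (τ⁻¹ c) τ⁻¹) := by
      intro f'
      rw [sandwich_apply, hg₂, sandwich_apply, adjEquiv_toLinearMap, LinearMap.comp_assoc]
    constructor
    · rintro ⟨f', hf', rfl⟩
      exact ⟨_, (exists_comp_mono_eq_iff J (by simpa using hc) τ _).1 ⟨f', hf', rfl⟩,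
        (hs f').symm⟩
    · rintro ⟨f'', hf'', rfl⟩
      obtain ⟨f', hf', rfl⟩ :=
        (exists_comp_mono_eq_iff J (c := τ⁻¹ c) (by simpa using hc) τ _).2 hf''
      exact ⟨f', hf', hs f'⟩
  refine ⟨τ, hstab _ fun j hj => ?_, hV⟩
  rw [hV] at hadj
  have hj' : j⁻¹ * τ⁻¹ ∈ {υ | υ * τ ∈ J} := by
    rw [Set.mem_ofPred_eq, inv_mul_cancel_right, ← Set.mem_inv, hinv]
    exact hj
  obtain ⟨f, hf, h⟩ := hadj _ (Submodule.mem_map_of_mem (mono_mem_supportedOn 1 hj'))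
  simp only [LinearEquiv.coe_coe, adj_sandwich, adjEquiv_adjEquiv] at h
  have hf1 := (sandwich g₁ (adjEquiv g₁)).injective h
  by_contra hn
  have h0 := mem_supportedOn.1 hf (j⁻¹ * τ⁻¹)⁻¹ (fun h => hn (by
    rwa [Set.mem_ofPred_eq, mul_inv_rev, inv_inv, inv_inv, mul_assoc, gal_mul_comm j,
      ← mul_assoc] at h))
  rw [hf1, coef_adj, inv_inv, coef_mono_self, map_one] at h0
  exact one_ne_zero h0

/-! ### The two notions of equivalence -/

theorem twist_zero (ρ : K ≃+* K) : twist ρ (0 : Module.End F K) = 0 := by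
  ext x; simp [twist]

theorem twist_twist_symm (ρ : K ≃+* K) (f : Module.End F K) : twist ρ (twist ρ.symm f) = f := by
  ext x; simp [twist]

theorem twist_refl (f : Module.End F K) : twist (RingEquiv.refl K) f = f := rfl

/-- A subspace equivalent to `supportedOn J` is obtained from it by a linear sandwich: the twist
preserves `supportedOn J`, and the translation vector lies in the subspace. -/
theorem equivalent_supportedOn_iff {J : Set Gal(K/F)} {V : Submodule F (Module.End F K)} :
    Equivalent (supportedOn J : Set (Module.End F K)) V ↔
      ∃ g₁ g₂ : K ≃ₗ[F] K, V = (supportedOn J).map (sandwich g₁ g₂).toLinearMap := by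
  constructor
  · rintro ⟨g₁, g₂, ρ, h, hV⟩
    have hmem : ∀ x, x ∈ V ↔ ∃ f ∈ supportedOn J, sandwich g₁ g₂ (twist ρ f) + h = x :=
      fun x => Set.ext_iff.1 hV x
    have hh : h ∈ V := (hmem h).2 ⟨0, zero_mem _, by rw [twist_zero, map_zero, zero_add]⟩
    refine ⟨g₁, g₂, Submodule.ext fun x => ⟨fun hx => ?_, ?_⟩⟩
    · obtain ⟨f, hf, e⟩ := (hmem (x + h)).1 (V.add_mem hx hh)
      exact ⟨twist ρ f, twist_mem_supportedOn ρ hf, add_right_cancel e⟩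
    · rintro ⟨f, hf, rfl⟩
      have := (hmem (sandwich g₁ g₂ f + h)).2
        ⟨twist ρ.symm f, twist_mem_supportedOn _ hf, by rw [twist_twist_symm]⟩
      simpa using V.sub_mem this hh
  · rintro ⟨g₁, g₂, rfl⟩
    refine ⟨g₁, g₂, RingEquiv.refl K, 0, ?_⟩
    ext x
    simp [twist_refl, sandwich_apply]

/-- An additive group equivalent to a subspace `C` of `X` is the image of `C` under a congruence,
provided `C` is invariant under twists. -/
theorem equivalentIn_iff {X C : Submodule F (Module.End F K)}
    (htw : ∀ (ρ : K ≃+* K), ∀ f ∈ C, twist ρ f ∈ C) {D : AddSubgroup (Module.End F K)} :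
    EquivalentIn (X : Set (Module.End F K)) C D ↔
      ∃ g : K ≃ₗ[F] K,
        (D : Set (Module.End F K)) = C.map (sandwich g (adjEquiv g)).toLinearMap := by
  constructor
  · rintro ⟨a, g, ρ, r, ha, -, hD⟩
    have hmem : ∀ x, x ∈ D ↔ ∃ f ∈ C, a • sandwich g (adjEquiv g) (twist ρ f) + r = x :=
      fun x => Set.ext_iff.1 hD x
    have hr : r ∈ D := (hmem r).2
      ⟨0, zero_mem _, by rw [twist_zero, map_zero, smul_zero, zero_add]⟩
    refine ⟨g, Set.ext fun x => ⟨fun hx => ?_, ?_⟩⟩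
    · obtain ⟨f, hf, e⟩ := (hmem (x + r)).1 (D.add_mem hx hr)
      refine ⟨a • twist ρ f, C.smul_mem a (htw ρ f hf), ?_⟩
      rw [map_smul]
      exact add_right_cancel e
    · rintro ⟨f, hf, rfl⟩
      have := (hmem (sandwich g (adjEquiv g) f + r)).2
        ⟨twist ρ.symm (a⁻¹ • f), htw _ _ (C.smul_mem _ hf), by
          rw [twist_twist_symm, map_smul, smul_inv_smul₀ ha]⟩
      simpa using D.sub_mem this hr
  · rintro ⟨g, hD⟩
    refine ⟨1, g, RingEquiv.refl K, 0, one_ne_zero, X.zero_mem, ?_⟩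
    rw [hD]
    ext x
    simp [twist_refl, sandwich_apply]

theorem mem_of_sandwich_mem {X : Submodule F (Module.End F K)}
    (hX : ∀ (g : K ≃ₗ[F] K) (f : Module.End F K), f ∈ X → sandwich g (adjEquiv g) f ∈ X)
    (g : K ≃ₗ[F] K) (f : Module.End F K) (hf : sandwich g (adjEquiv g) f ∈ X) : f ∈ X := by
  have := hX g.symm _ hf
  rwa [show adjEquiv g.symm = (adjEquiv g).symm from rfl, ← sandwich_symm,
    LinearEquiv.symm_apply_apply] at this

/-- For a congruence-invariant space `X` and a self-adjoint support space: if `X ∩ supportedOn J`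
determines `supportedOn J` among its sandwiches, then every code equivalent to
`X ∩ supportedOn J` is the intersection of `X` with exactly one self-adjoint space equivalent to
`supportedOn J`. -/
theorem existsUnique_of_equivalentIn {J : Set Gal(K/F)} {X : Submodule F (Module.End F K)}
    (hinv : J⁻¹ = J)
    (hX : ∀ (g : K ≃ₗ[F] K) (f : Module.End F K), f ∈ X → sandwich g (adjEquiv g) f ∈ X)
    (hXtw : ∀ (ρ : K ≃+* K), ∀ f ∈ X, twist ρ f ∈ X)
    (huniq : ∀ h₁ h₂ : K ≃ₗ[F] K,
      (∀ f ∈ supportedOn J ⊓ X, sandwich h₁ h₂ f ∈ supportedOn J) →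
      ∀ f ∈ supportedOn J, sandwich h₁ h₂ f ∈ supportedOn J)
    {D : AddSubgroup (Module.End F K)}
    (hD : EquivalentIn (X : Set (Module.End F K))
      (supportedOn J ⊓ X : Submodule F (Module.End F K)) D) :
    ∃! V : Submodule F (Module.End F K),
      Equivalent (supportedOn J : Set (Module.End F K)) V ∧
      (V : Set (Module.End F K)) = adj '' (V : Set (Module.End F K)) ∧
      (V : Set (Module.End F K)) ∩ X = D := by
  obtain ⟨g, hD⟩ := (equivalentIn_iff (C := supportedOn J ⊓ X) fun ρ f hf =>
    ⟨twist_mem_supportedOn ρ hf.1, hXtw ρ f hf.2⟩).1 hD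
  have hX' := mem_of_sandwich_mem hX g
  have hadj : ∀ f ∈ (supportedOn J).map (sandwich g (adjEquiv g)).toLinearMap,
      adj f ∈ (supportedOn J).map (sandwich g (adjEquiv g)).toLinearMap := by
    rintro _ ⟨f, hf, rfl⟩
    refine ⟨adj f, hinv ▸ adj_mem_supportedOn hf, ?_⟩
    simp only [LinearEquiv.coe_coe, adj_sandwich, adjEquiv_adjEquiv]
  refine ⟨(supportedOn J).map (sandwich g (adjEquiv g)).toLinearMap,
    ⟨equivalent_supportedOn_iff.2 ⟨g, _, rfl⟩, ?_, ?_⟩, ?_⟩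
  · ext f
    exact ⟨fun hf => ⟨adj f, hadj f hf, adj_adj f⟩, by rintro ⟨f, hf, rfl⟩; exact hadj f hf⟩
  · rw [hD]
    ext f
    constructor
    · rintro ⟨⟨f, hf, rfl⟩, hfX⟩
      exact ⟨f, ⟨hf, hX' f hfX⟩, rfl⟩
    · rintro ⟨f, ⟨hf, hfX⟩, rfl⟩
      exact ⟨⟨f, hf, rfl⟩, hX g f hfX⟩
  · rintro V ⟨hV, -, hVD⟩
    obtain ⟨g₁, g₂, rfl⟩ := equivalent_supportedOn_iff.1 hV
    -- the sandwich taking the given space to `V`, followed by the inverse of the other one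
    have key := huniq (g ≪≫ₗ g₁.symm) (g₂.symm ≪≫ₗ adjEquiv g) (fun f hf => by
      have hfD : sandwich g (adjEquiv g) f ∈ (D : Set (Module.End F K)) := by
        rw [hD]
        exact ⟨f, hf, rfl⟩
      rw [← hVD] at hfD
      obtain ⟨f', hf', e⟩ := hfD.1
      rw [← sandwich_sandwich, ← e, ← sandwich_symm]
      simpa using hf')
    refine (Submodule.eq_of_le_of_finrank_eq ?_ ?_).symm
    · rintro _ ⟨f, hf, rfl⟩
      refine ⟨_, key f hf, ?_⟩
      rw [← sandwich_sandwich, ← sandwich_symm]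
      exact LinearEquiv.apply_symm_apply _ _
    · rw [LinearEquiv.finrank_map_eq, LinearEquiv.finrank_map_eq]

/-- A code cut out of `X` by a self-adjoint space equivalent to `supportedOn J` is equivalent to
`X ∩ supportedOn J`, provided the sections of `X` by the translates of `supportedOn J` by
involutions are not equivalent to it. -/
theorem equivalentIn_of_exists {J : Set Gal(K/F)} {X : Submodule F (Module.End F K)}
    (hinv : J⁻¹ = J) (hstab : ∀ t, (∀ j ∈ J, t * j ∈ J) → t = 1)
    (hX : ∀ (g : K ≃ₗ[F] K) (f : Module.End F K), f ∈ X → sandwich g (adjEquiv g) f ∈ X)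
    (hXtw : ∀ (ρ : K ≃+* K), ∀ f ∈ X, twist ρ f ∈ X)
    {D : AddSubgroup (Module.End F K)}
    (hinvol : ∀ (g : K ≃ₗ[F] K) (τ : Gal(K/F)), τ * τ = 1 → (D : Set (Module.End F K)) =
      (supportedOn {υ | υ * τ ∈ J} ⊓ X).map (sandwich g (adjEquiv g)).toLinearMap → τ = 1)
    {V : Submodule F (Module.End F K)}
    (hV : Equivalent (supportedOn J : Set (Module.End F K)) V)
    (hVadj : (V : Set (Module.End F K)) = adj '' (V : Set (Module.End F K)))
    (hVD : (V : Set (Module.End F K)) ∩ X = D) :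
    EquivalentIn (X : Set (Module.End F K))
      (supportedOn J ⊓ X : Submodule F (Module.End F K)) D := by
  rw [equivalentIn_iff (C := supportedOn J ⊓ X) fun ρ f hf =>
    ⟨twist_mem_supportedOn ρ hf.1, hXtw ρ f hf.2⟩]
  obtain ⟨g₁, g₂, rfl⟩ := equivalent_supportedOn_iff.1 hV
  obtain ⟨τ, hτ, e⟩ := exists_map_sandwich_eq hinv hstab g₁ g₂ fun f hf => by
    rw [← SetLike.mem_coe, hVadj]
    exact ⟨f, hf, rfl⟩
  have hX' := mem_of_sandwich_mem hX g₁
  have hD : (D : Set (Module.End F K)) =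
      (supportedOn {υ | υ * τ ∈ J} ⊓ X).map (sandwich g₁ (adjEquiv g₁)).toLinearMap := by
    rw [← hVD, e]
    ext f
    constructor
    · rintro ⟨⟨f, hf, rfl⟩, hfX⟩
      exact ⟨f, ⟨hf, hX' f hfX⟩, rfl⟩
    · rintro ⟨f, ⟨hf, hfX⟩, rfl⟩
      exact ⟨⟨f, hf, rfl⟩, hX g₁ f hfX⟩
  have h1 := hinvol g₁ τ hτ hD
  subst h1
  refine ⟨g₁, ?_⟩
  simpa using hD

/-! ### Self-adjoint and alternating maps -/

variable (F K) in
/-- The self-adjoint maps, as a subspace. -/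
def symSubmodule : Submodule F (Module.End F K) where
  carrier := symSpace F K
  add_mem' {f g} (hf : adj f = f) (hg : adj g = g) := by
    change adj (f + g) = f + g
    rw [adj_add, hf, hg]
  zero_mem' := by
    change adj 0 = 0
    simpa using adj_smul (0 : F) (0 : Module.End F K)
  smul_mem' c f (hf : adj f = f) := by
    change adj (c • f) = c • f
    rw [adj_smul, hf]

variable (F K) in
/-- The alternating maps, as a subspace. -/
def altSubmodule : Submodule F (Module.End F K) where
  carrier := altSpace F K
  add_mem' {f g} hf hg x := by
    rw [LinearMap.add_apply, add_mul, map_add, hf x, hg x, add_zero]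
  zero_mem' x := by simp
  smul_mem' c f hf x := by
    rw [LinearMap.smul_apply, smul_mul_assoc, map_smul, hf x, smul_zero]

theorem mem_symSubmodule {f : Module.End F K} : f ∈ symSubmodule F K ↔ adj f = f := Iff.rfl

theorem coe_symSubmodule : (symSubmodule F K : Set (Module.End F K)) = symSpace F K := rfl

theorem coe_altSubmodule : (altSubmodule F K : Set (Module.End F K)) = altSpace F K := rfl

theorem sandwich_mem_symSubmodule (g : K ≃ₗ[F] K) (f : Module.End F K)
    (hf : f ∈ symSubmodule F K) : sandwich g (adjEquiv g) f ∈ symSubmodule F K := by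
  rw [mem_symSubmodule, adj_sandwich, adjEquiv_adjEquiv, mem_symSubmodule.1 hf]

theorem sandwich_mem_altSubmodule (g : K ≃ₗ[F] K) (f : Module.End F K)
    (hf : f ∈ altSubmodule F K) : sandwich g (adjEquiv g) f ∈ altSubmodule F K := by
  intro x
  have := hf (adj g.toLinearMap x)
  rwa [mul_comm, trace_adj, mul_comm] at this

theorem twist_mem_symSubmodule (ρ : K ≃+* K) (f : Module.End F K)
    (hf : f ∈ symSubmodule F K) : twist ρ f ∈ symSubmodule F K := by
  refine eq_of_coef_eq fun τ => ?_
  rw [coef_adj, coef_twist, coef_twist, ← ringEquiv_comm, ← coef_adj, mem_symSubmodule.1 hf]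

theorem twist_mem_altSubmodule (ρ : K ≃+* K) (f : Module.End F K)
    (hf : f ∈ altSubmodule F K) : twist ρ f ∈ altSubmodule F K := by
  intro x
  have : Finite K := Module.finite_of_finite F
  have h := congrArg (algebraMap F K) (hf (ρ.symm x))
  rw [trace_eq_sum_automorphisms, map_zero] at h
  apply (algebraMap F K).injective
  rw [trace_eq_sum_automorphisms, map_zero, ← map_zero ρ, ← h, map_sum]
  refine Finset.sum_congr rfl fun τ _ => ?_
  rw [ringEquiv_comm, map_mul ρ, RingEquiv.apply_symm_apply]
  rfl

theorem adj_eq_neg_of_mem_altSubmodule {f : Module.End F K} (hf : f ∈ altSubmodule F K) :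
    adj f = -f := by
  refine (adj_unique f (-f) fun x y => ?_).symm
  have h := hf (x + y)
  simp only [map_add, add_mul, mul_add] at h
  rw [hf x, hf y, zero_add, add_zero] at h
  rw [LinearMap.neg_apply, neg_mul, map_neg, mul_comm x]
  exact neg_eq_of_add_eq_zero_left h

theorem add_adj_mem_symSubmodule (f : Module.End F K) : f + adj f ∈ symSubmodule F K := by
  rw [mem_symSubmodule, adj_add, adj_adj, add_comm]

theorem sub_adj_mem_altSubmodule (f : Module.End F K) : f - adj f ∈ altSubmodule F K := by
  intro x
  rw [LinearMap.sub_apply, sub_mul, map_sub, trace_adj, mul_comm, sub_self]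

theorem mono_one_mem_symSubmodule (b : K) : mono b (1 : Gal(K/F)) ∈ symSubmodule F K := by
  rw [mem_symSubmodule, adj_mono, inv_one, AlgEquiv.one_apply]

/-! ### Cyclic intervals of automorphisms -/

/-- The automorphisms `σ ^ j₀, σ ^ (j₀ + 1), …, σ ^ (j₀ + k - 1)`. -/
def interval (σ : Gal(K/F)) (j₀ : ℤ) (k : ℕ) : Set Gal(K/F) :=
  {τ | ∃ i : ℕ, i < k ∧ τ = σ ^ (j₀ + i)}

variable {σ : Gal(K/F)} {j₀ : ℤ} {k : ℕ}

theorem zpow_mem_interval {a : ℤ} (h₁ : j₀ ≤ a) (h₂ : a < j₀ + k) : σ ^ a ∈ interval σ j₀ k :=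
  ⟨(a - j₀).toNat, by omega, by congr 1; omega⟩

theorem eq_of_zpow_eq_zpow {a b : ℤ} (h : σ ^ a = σ ^ b) (h₁ : a - b < orderOf σ)
    (h₂ : b - a < orderOf σ) : a = b := by
  obtain ⟨c, hc⟩ := (zpow_eq_zpow_iff_modEq.1 h).dvd
  have hc0 : c = 0 := by nlinarith
  rw [hc0, mul_zero] at hc
  omega

theorem zpow_mem_interval_iff (hk : k ≤ orderOf σ) {a : ℤ} (h₁ : j₀ ≤ a)
    (h₂ : a < j₀ + orderOf σ) : σ ^ a ∈ interval σ j₀ k ↔ a < j₀ + k := by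
  refine ⟨?_, zpow_mem_interval h₁⟩
  rintro ⟨i, hi, h⟩
  have := eq_of_zpow_eq_zpow h (by omega) (by omega)
  omega

theorem interval_inv (h : ∃ c : ℤ, 2 * j₀ + k - 1 = orderOf σ * c) :
    (interval σ j₀ k)⁻¹ = interval σ j₀ k := by
  obtain ⟨c, hc⟩ := h
  have key : ∀ τ ∈ interval σ j₀ k, τ⁻¹ ∈ interval σ j₀ k := by
    rintro _ ⟨i, hi, rfl⟩
    refine ⟨k - 1 - i, by omega, ?_⟩
    rw [← zpow_neg, zpow_eq_zpow_iff_modEq]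
    refine (Int.modEq_iff_dvd).2 ⟨c, ?_⟩
    rw [← hc]
    omega
  ext τ
  exact ⟨fun h => by simpa using key _ h, key τ⟩

theorem exists_zpow_eq (hgen : ∀ τ, τ ∈ Subgroup.zpowers σ) (τ : Gal(K/F)) (j₀ : ℤ) :
    ∃ a, j₀ ≤ a ∧ a < j₀ + orderOf σ ∧ σ ^ a = τ := by
  obtain ⟨b, rfl⟩ := hgen τ
  have hpos : (0 : ℤ) < orderOf σ := by exact_mod_cast orderOf_pos σ
  refine ⟨j₀ + (b - j₀) % orderOf σ, by have := Int.emod_nonneg (b - j₀) hpos.ne'; omega,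
    by have := Int.emod_lt_of_pos (b - j₀) hpos; omega, ?_⟩
  change _ = σ ^ b
  rw [zpow_eq_zpow_iff_modEq]
  have := Int.mod_modEq (b - j₀) (orderOf σ)
  simpa using (Int.ModEq.refl j₀).add this

/-- A proper nonempty interval contains none of its nontrivial translates. -/
theorem eq_one_of_mul_mem_interval (hgen : ∀ τ, τ ∈ Subgroup.zpowers σ) (hk : k < orderOf σ)
    (hk0 : 0 < k) (t : Gal(K/F)) (ht : ∀ j ∈ interval σ j₀ k, t * j ∈ interval σ j₀ k) :
    t = 1 := by
  obtain ⟨a, ha0, ha, rfl⟩ := exists_zpow_eq hgen t 0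
  by_contra hne
  have ha1 : a ≠ 0 := by rintro rfl; exact hne (zpow_zero σ)
  have h0 := ht (σ ^ j₀) (zpow_mem_interval le_rfl (by omega))
  rw [← zpow_add, zpow_mem_interval_iff hk.le (by omega) (by omega)] at h0
  -- the translate of `σ ^ (j₀ + k - a)` is the first element beyond the interval
  have h1 := ht (σ ^ (j₀ + k - a)) (zpow_mem_interval (by omega) (by omega))
  rw [← zpow_add, zpow_mem_interval_iff hk.le (by omega) (by omega)] at h1
  omega

/-- The support `J = {σ ^ i | d / 2 ≤ i ≤ n - d / 2}` of the alternating codes satisfies the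
hypothesis of `sandwich_supportedOn_le_of_alt`.  As `d / 2 ≥ 2`, neither `σ` nor `σ⁻¹` is in `J`;
since `J = J⁻¹` is an interval with at least two elements, one of them is in `t J`. -/
theorem exists_notMem_interval {n d : ℕ} (hn : orderOf σ = n) (hgen : ∀ τ, τ ∈ Subgroup.zpowers σ)
    (hodd : Odd n) (hd : Even d) (hd4 : 4 ≤ d) (hdn : d < n) :
    ∀ t ∈ interval σ (d / 2 : ℕ) (n - d + 1),
      ∃ z ∉ interval σ (d / 2 : ℕ) (n - d + 1),
        z ≠ 1 ∧ t⁻¹ * z ∈ interval σ (d / 2 : ℕ) (n - d + 1) := by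
  obtain ⟨e, rfl⟩ := hd
  obtain ⟨m, rfl⟩ := hodd
  rw [show (e + e) / 2 = e by omega]
  set J := interval σ e (2 * m + 1 - (e + e) + 1) with hJ
  have hinv : J⁻¹ = J := interval_inv ⟨1, by omega⟩
  have hmem : ∀ a : ℤ, e ≤ a → a < e + (2 * m + 1 : ℕ) → (σ ^ a ∈ J ↔ a ≤ 2 * m + 1 - e) := by
    intro a h₁ h₂
    rw [hJ, zpow_mem_interval_iff (by omega) h₁ (by omega)]
    omega
  have hσ : σ ∉ J := by
    have e1 : σ = σ ^ (2 * m + 1 + 1 : ℤ) := by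
      rw [zpow_add, show (2 * m + 1 : ℤ) = ((2 * m + 1 : ℕ) : ℤ) by norm_num, ← hn,
        zpow_natCast, pow_orderOf_eq_one, one_mul, zpow_one]
    rw [e1, hmem _ (by omega) (by omega)]
    omega
  have hσ1 : σ ≠ 1 := by
    rintro rfl
    rw [orderOf_one] at hn
    omega
  intro t ht
  obtain ⟨a, ha, ha', rfl⟩ := exists_zpow_eq hgen t e
  have ha2 := (hmem a ha (by omega)).1 ht
  by_cases hae : a = e
  · refine ⟨σ⁻¹, fun h => hσ (by rw [← hinv]; exact h), inv_ne_one.2 hσ1, ?_⟩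
    rw [← hinv, Set.mem_inv, mul_inv_rev, inv_inv, inv_inv, ← zpow_one_add,
      hmem _ (by omega) (by omega)]
    omega
  · refine ⟨σ, hσ, hσ1, ?_⟩
    rw [← hinv, Set.mem_inv, mul_inv_rev, inv_inv, ← zpow_neg_one, ← zpow_add,
      hmem _ (by omega) (by omega)]
    omega

/-- A map supported on the image of an injective family is the sum of its monomials along the
family. -/
theorem eq_sum_mono {ι : Type*} {s : Finset ι} {p : ι → Gal(K/F)} (hp : Set.InjOn p s)
    {f : Module.End F K} (hf : f ∈ supportedOn {τ | ∃ i ∈ s, τ = p i}) :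
    f = ∑ i ∈ s, mono (coef f (p i)) (p i) := by
  classical
  rw [← Finset.sum_image (f := fun τ => mono (coef f τ) τ) hp]
  conv_lhs => rw [← ofCoef_coef f, ofCoef_eq_sum]
  refine (Finset.sum_subset (Finset.subset_univ _) fun τ _ hτ => ?_).symm
  rw [mem_supportedOn.1 hf, mono_zero]
  rintro ⟨i, hi, rfl⟩
  exact hτ (Finset.mem_image_of_mem p hi)

/-! ### Kernels -/

/-- A nonzero `σ`-polynomial of degree at most `k` has kernel of dimension at most `k`, if the
fixed field of `σ` is `F`.  For `v ≠ 0` in the kernel, `y ↦ f (v y)` vanishes at `1`, so it factors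
as `g ∘ (σ - 1)` with `g` of degree at most `k - 1`. -/
theorem finrank_ker_le (hσ : ∀ x : K, σ x = x → x ∈ Set.range (algebraMap F K)) (k : ℕ) :
    ∀ a : ℕ → K, (∃ i ≤ k, a i ≠ 0) → Module.finrank F
      (LinearMap.ker (∑ i ∈ Finset.range (k + 1), mono (a i) (σ ^ i))) ≤ k := by
  induction k with
  | zero =>
    rintro a ⟨i, hi, ha⟩
    obtain rfl : i = 0 := by omega
    rw [Nat.le_zero, Submodule.finrank_eq_zero, LinearMap.ker_eq_bot']
    intro x hx
    simpa [ha] using hx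
  | succ k ih =>
    rintro a ⟨i₀, hi₀, ha⟩
    set f : Module.End F K := ∑ i ∈ Finset.range (k + 1 + 1), mono (a i) (σ ^ i) with hf
    by_cases hker : LinearMap.ker f = ⊥
    · rw [hker, finrank_bot]
      omega
    obtain ⟨v, hv, hv0⟩ := (Submodule.ne_bot_iff _).1 hker
    let b : ℕ → K := fun i => a i * (σ ^ i) v
    have hfb : ∀ y, f (v * y) = ∑ i ∈ Finset.range (k + 1 + 1), b i * (σ ^ i) y := by
      intro y
      simp [hf, b, LinearMap.sum_apply, mul_assoc]
    have hb0 : ∑ i ∈ Finset.range (k + 1 + 1), b i = 0 := by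
      have := hfb 1
      rw [mul_one, LinearMap.mem_ker.1 hv] at this
      simpa using this.symm
    let c : ℕ → K := fun i => -∑ l ∈ Finset.range (i + 1), b l
    have hc : ∃ i ≤ k, c i ≠ 0 := by
      by_contra! h
      have hS : ∀ i ≤ k + 1, ∑ l ∈ Finset.range (i + 1), b l = 0 := by
        intro i hi
        rcases Nat.lt_or_ge i (k + 1) with h' | h'
        · exact neg_eq_zero.1 (h i (by omega))
        · obtain rfl : i = k + 1 := by omega
          exact hb0
      have hb : b i₀ = 0 := by
        have h1 := hS i₀ hi₀
        rw [Finset.sum_range_succ] at h1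
        rcases Nat.eq_zero_or_pos i₀ with rfl | hpos
        · simpa using h1
        · have h2 := hS (i₀ - 1) (by omega)
          rw [Nat.sub_add_cancel hpos] at h2
          rwa [h2, zero_add] at h1
      have : (σ ^ i₀) v ≠ 0 := (map_ne_zero _).2 hv0
      exact (mul_ne_zero ha this) hb
    set g : Module.End F K := ∑ i ∈ Finset.range (k + 1), mono (c i) (σ ^ i) with hg
    set T : Module.End F K := σ.toLinearMap - LinearMap.id with hT
    have habel : ∀ (z : ℕ → K) (N : ℕ), ∑ i ∈ Finset.range N, c i * (z (i + 1) - z i) =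
        ∑ i ∈ Finset.range N, b i * z i - (∑ l ∈ Finset.range N, b l) * z N := by
      intro z N
      induction N with
      | zero => simp
      | succ N ihN =>
        rw [Finset.sum_range_succ, ihN, Finset.sum_range_succ (fun i => b i * z i)]
        simp only [c, Finset.sum_range_succ]
        ring
    have hfg : ∀ y, f (v * y) = g (T y) := by
      intro y
      have h1 : g (T y) = ∑ i ∈ Finset.range (k + 1), c i * ((σ ^ (i + 1)) y - (σ ^ i) y) := by
        simp [hg, hT, LinearMap.sum_apply, pow_succ]
      have h2 := habel (fun i => (σ ^ i) y) (k + 1)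
      rw [h1, h2, hfb, Finset.sum_range_succ _ (k + 1)]
      rw [Finset.sum_range_succ _ (k + 1)] at hb0
      linear_combination (σ ^ (k + 1)) y * hb0
    -- the map `x ↦ (σ - 1) (v⁻¹ x)` sends `ker f` to `ker g`, with kernel spanned by `v`
    let R : Module.End F K := T ∘ₗ LinearMap.mulLeft F v⁻¹
    have hfR : ∀ x, f x = g (R x) := by
      intro x
      have := hfg (v⁻¹ * x)
      rwa [mul_inv_cancel_left₀ hv0] at this
    have hrn := LinearMap.finrank_range_add_finrank_ker (R.domRestrict (LinearMap.ker f))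
    have h1 : Module.finrank F (LinearMap.range (R.domRestrict (LinearMap.ker f))) ≤ k := by
      refine (Submodule.finrank_mono ?_).trans (ih c hc)
      rintro _ ⟨x, rfl⟩
      have := x.2
      rw [LinearMap.mem_ker, hfR] at this
      exact this
    have h2 : Module.finrank F (LinearMap.ker (R.domRestrict (LinearMap.ker f))) ≤ 1 := by
      refine finrank_le_one ⟨⟨v, hv⟩, ?_⟩ ?_
      · simp [LinearMap.mem_ker, R, hT, hv0]
      · rintro ⟨⟨x, hx⟩, hx'⟩
        have : σ (v⁻¹ * x) = v⁻¹ * x := by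
          rw [LinearMap.mem_ker] at hx'
          exact sub_eq_zero.1 hx'
        obtain ⟨r, hr⟩ := hσ _ this
        refine ⟨r, Subtype.ext (Subtype.ext ?_)⟩
        change r • v = x
        rw [Algebra.smul_def, hr, mul_comm, mul_inv_cancel_left₀ hv0]
    omega

theorem mem_range_algebraMap_of_fixed (hgen : ∀ τ, τ ∈ Subgroup.zpowers σ) {x : K}
    (hx : σ x = x) : x ∈ Set.range (algebraMap F K) := by
  have : Finite K := Module.finite_of_finite F
  rw [IsGalois.mem_range_algebraMap_iff_fixed]
  intro τ
  have hle : Subgroup.zpowers σ ≤ MulAction.stabilizer Gal(K/F) x := by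
    rw [Subgroup.zpowers_le]
    exact hx
  exact hle (hgen τ)

/-- A nonzero map supported on an interval of length `k` has rank at least `n - k + 1`. -/
theorem le_rk_of_mem_supportedOn_interval (hgen : ∀ τ, τ ∈ Subgroup.zpowers σ)
    (hk : k ≤ orderOf σ) {f : Module.End F K} (hf : f ∈ supportedOn (interval σ j₀ k))
    (hf0 : f ≠ 0) : Module.finrank F K + 1 ≤ rk f + k := by
  have hinj : Set.InjOn (fun i : ℕ => σ ^ (j₀ + i)) (Finset.range k) := by
    intro i hi j hj h
    have hi' := Finset.mem_range.1 hi
    have hj' := Finset.mem_range.1 hj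
    have := eq_of_zpow_eq_zpow h (by omega) (by omega)
    omega
  have hsum := eq_sum_mono (f := f) hinj (by simpa [interval] using hf)
  set a : ℕ → K := fun i => coef f (σ ^ (j₀ + i)) with ha
  have ha0 : ∃ i < k, a i ≠ 0 := by
    by_contra! h
    apply hf0
    rw [hsum]
    refine Finset.sum_eq_zero fun i hi => ?_
    change mono (a i) _ = 0
    rw [h i (Finset.mem_range.1 hi), mono_zero]
  obtain ⟨i, hi, hai⟩ := ha0
  obtain ⟨k, rfl⟩ : ∃ k', k = k' + 1 := ⟨k - 1, by omega⟩
  set g : Module.End F K := ∑ i ∈ Finset.range (k + 1), mono (a i) (σ ^ i) with hg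
  have hfg : f = g ∘ₗ (σ ^ j₀).toLinearMap := by
    rw [hsum]
    ext x
    simp only [LinearMap.sum_apply, hg, LinearMap.comp_apply, mono_apply,
      AlgEquiv.toLinearMap_apply, ← AlgEquiv.mul_apply]
    refine Finset.sum_congr rfl fun i _ => ?_
    rw [← zpow_natCast, ← zpow_add, add_comm (i : ℤ)]
  have hrk : rk f = rk g := by
    rw [rk, hfg, LinearMap.range_comp_of_range_eq_top, rk]
    exact LinearMap.range_eq_top.2 (σ ^ j₀).surjective
  have h1 : Module.finrank F (LinearMap.ker g) ≤ k :=
    finrank_ker_le (fun x => mem_range_algebraMap_of_fixed hgen) k a ⟨i, by omega, hai⟩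
  have h2 : rk g + _ = _ := LinearMap.finrank_range_add_finrank_ker g
  rw [hrk]
  omega

/-! ### The codes as sections of support spaces -/

theorem neg_one_smul_end (f : Module.End F K) : (-1 : F) • f = -f := by
  ext x; simp

/-- The sum of the maps `bᵢ σ ^ i + c (bᵢ σ ^ i)^⊤` for `lo ≤ i ≤ hi`; the sign `c` is `1` for
self-adjoint maps and `-1` for alternating ones. -/
def pairSum (σ : Gal(K/F)) (c : F) (lo hi : ℕ) (b : ℕ → K) : Module.End F K :=
  ∑ i ∈ Finset.Icc lo hi, (mono (b i) (σ ^ i) + c • adj (mono (b i) (σ ^ i)))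

theorem coef_pairSum {c : F} {lo hi : ℕ} (hlo : 1 ≤ lo) (hhi : 2 * hi < orderOf σ) (b : ℕ → K)
    {i : ℕ} (hi' : i ≤ hi) : coef (pairSum σ c lo hi b) (σ ^ i) = if lo ≤ i then b i else 0 := by
  classical
  have hterm : ∀ j ∈ Finset.Icc lo hi,
      coef (mono (b j) (σ ^ j) + c • adj (mono (b j) (σ ^ j))) (σ ^ i) =
        if j = i then b i else 0 := by
    intro j hj
    obtain ⟨hj1, hj2⟩ := Finset.mem_Icc.1 hj
    have hne : σ ^ i ≠ (σ ^ j)⁻¹ := by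
      intro h
      have h1 : σ ^ (i + j) = 1 := by rw [pow_add, h, inv_mul_cancel]
      have := Nat.le_of_dvd (by omega) (orderOf_dvd_of_pow_eq_one h1)
      omega
    rw [map_add, map_smul, Pi.add_apply, Pi.smul_apply, adj_mono, coef_mono_of_ne _ hne,
      smul_zero, add_zero]
    by_cases h : j = i
    · rw [if_pos h, h, coef_mono_self]
    · rw [if_neg h, coef_mono_of_ne]
      intro e
      exact h (pow_injOn_Iio_orderOf (Set.mem_Iio.2 (by omega)) (Set.mem_Iio.2 (by omega)) e.symm)
  rw [pairSum, map_sum, Finset.sum_apply, Finset.sum_congr rfl hterm, Finset.sum_ite_eq']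
  simp [hi']

/-- The self-adjoint map with coefficients `b i` at `σ ^ i` for `0 ≤ i ≤ m`. -/
def symMap (σ : Gal(K/F)) (m : ℕ) (b : ℕ → K) : Module.End F K :=
  mono (b 0) 1 + pairSum σ 1 1 m b

theorem coef_symMap {m : ℕ} (hm : 2 * m < orderOf σ) (b : ℕ → K) {i : ℕ} (hi : i ≤ m) :
    coef (symMap σ m b) (σ ^ i) = b i := by
  rw [symMap, map_add, Pi.add_apply, coef_pairSum le_rfl hm b hi]
  rcases Nat.eq_zero_or_pos i with rfl | hpos
  · simp [coef_mono]
  · rw [if_pos (by omega), coef_mono_of_ne, zero_add]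
    intro h
    have := Nat.le_of_dvd hpos (orderOf_dvd_of_pow_eq_one h)
    omega

/-- A map with `adj f = c f` that is supported on `J` vanishes as soon as its coefficients on half
of `J` do. -/
theorem eq_zero_of_half {J : Set Gal(K/F)} {c : F} {f : Module.End F K} (hf : f ∈ supportedOn J)
    (hadj : adj f = c • f) (hhalf : ∀ τ ∈ J, coef f τ = 0 ∨ coef f τ⁻¹ = 0) : f = 0 := by
  refine eq_of_coef_eq fun τ => ?_
  rw [map_zero, Pi.zero_apply]
  by_cases hτ : τ ∈ J
  · rcases hhalf τ hτ with h | h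
    · exact h
    · have h1 := coef_adj f τ⁻¹
      have h2 := coef_adj f τ
      rw [h, map_zero, hadj, map_smul, Pi.smul_apply] at h2
      rcases smul_eq_zero.1 h2 with hc | h2
      · -- for `c = 0` the adjoint of `f` vanishes, hence so does `f`
        rw [inv_inv, hadj, hc, zero_smul, map_zero, Pi.zero_apply] at h1
        exact (map_eq_zero _).1 h1.symm
      · exact h2
  · exact hf τ hτ

theorem pairSum_mem_supportedOn {J : Set Gal(K/F)} (hinv : J⁻¹ = J) (c : F) {lo hi : ℕ}
    (h : ∀ i, lo ≤ i → i ≤ hi → σ ^ i ∈ J) (b : ℕ → K) : pairSum σ c lo hi b ∈ supportedOn J := by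
  refine Submodule.sum_mem _ fun i hi => ?_
  obtain ⟨h1, h2⟩ := Finset.mem_Icc.1 hi
  have hmem := mono_mem_supportedOn (b i) (h i h1 h2)
  refine Submodule.add_mem _ hmem (Submodule.smul_mem _ _ ?_)
  have := adj_mem_supportedOn hmem
  rwa [hinv] at this

theorem symMap_mem {m : ℕ} {J : Set Gal(K/F)} (hinv : J⁻¹ = J) (h : ∀ i ≤ m, σ ^ i ∈ J)
    (b : ℕ → K) : symMap σ m b ∈ supportedOn J ⊓ symSubmodule F K := by
  refine ⟨Submodule.add_mem _ (mono_mem_supportedOn _ (by simpa using h 0 (Nat.zero_le m)))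
    (pairSum_mem_supportedOn hinv 1 (fun i _ hi => h i hi) b),
    Submodule.add_mem _ (mono_one_mem_symSubmodule _) (Submodule.sum_mem _ fun i _ => ?_)⟩
  rw [one_smul]
  exact add_adj_mem_symSubmodule _

theorem mem_supportedOn_inf_symSubmodule_iff {m : ℕ} (hm : 2 * m < orderOf σ)
    {J : Set Gal(K/F)} (hinv : J⁻¹ = J) (h : ∀ i ≤ m, σ ^ i ∈ J)
    (hJ : ∀ τ ∈ J, ∃ i ≤ m, τ = σ ^ i ∨ τ⁻¹ = σ ^ i) {f : Module.End F K} :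
    f ∈ supportedOn J ⊓ symSubmodule F K ↔ ∃ b, f = symMap σ m b := by
  refine ⟨fun hf => ⟨fun i => coef f (σ ^ i), ?_⟩, by rintro ⟨b, rfl⟩; exact symMap_mem hinv h b⟩
  have hmem := Submodule.sub_mem _ hf (symMap_mem hinv h fun i => coef f (σ ^ i))
  refine sub_eq_zero.1 (eq_zero_of_half (c := 1) hmem.1 ?_ fun τ hτ => ?_)
  · rw [one_smul]
    exact hmem.2
  · have key : ∀ i ≤ m, coef (f - symMap σ m fun i => coef f (σ ^ i)) (σ ^ i) = 0 := by
      intro i hi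
      rw [map_sub, Pi.sub_apply, coef_symMap hm _ hi, sub_self]
    obtain ⟨i, hi, e | e⟩ := hJ τ hτ
    · exact Or.inl (e ▸ key i hi)
    · exact Or.inr (e ▸ key i hi)

theorem mem_supportedOn_inf_altSubmodule_iff {lo hi : ℕ} (hlo : 1 ≤ lo)
    (hhi : 2 * hi < orderOf σ) {J : Set Gal(K/F)} (hinv : J⁻¹ = J)
    (h : ∀ i, lo ≤ i → i ≤ hi → σ ^ i ∈ J)
    (hJ : ∀ τ ∈ J, ∃ i, lo ≤ i ∧ i ≤ hi ∧ (τ = σ ^ i ∨ τ⁻¹ = σ ^ i)) {f : Module.End F K} :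
    f ∈ supportedOn J ⊓ altSubmodule F K ↔ ∃ b, f = pairSum σ (-1) lo hi b := by
  have hpair : ∀ b, pairSum σ (-1) lo hi b ∈ supportedOn J ⊓ altSubmodule F K := by
    refine fun b => ⟨pairSum_mem_supportedOn hinv _ h b, Submodule.sum_mem _ fun i _ => ?_⟩
    rw [neg_one_smul_end, ← sub_eq_add_neg]
    exact sub_adj_mem_altSubmodule _
  refine ⟨fun hf => ⟨fun i => coef f (σ ^ i), ?_⟩, by rintro ⟨b, rfl⟩; exact hpair b⟩
  have hmem := Submodule.sub_mem _ hf (hpair fun i => coef f (σ ^ i))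
  refine sub_eq_zero.1 (eq_zero_of_half (c := -1) hmem.1 ?_ fun τ hτ => ?_)
  · rw [neg_one_smul_end]
    exact adj_eq_neg_of_mem_altSubmodule hmem.2
  · have key : ∀ i, lo ≤ i → i ≤ hi →
        coef (f - pairSum σ (-1) lo hi fun i => coef f (σ ^ i)) (σ ^ i) = 0 := by
      intro i h1 h2
      rw [map_sub, Pi.sub_apply, coef_pairSum hlo hhi _ h2, if_pos h1, sub_self]
    obtain ⟨i, h1, h2, e | e⟩ := hJ τ hτ
    · exact Or.inl (e ▸ key i h1 h2)
    · exact Or.inr (e ▸ key i h1 h2)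

/-- The self-adjoint maps supported on the translate of `J` by an automorphism `τ` of order two are
fewer than those supported on `J`: the coefficient at the centre `τ` of the translate is fixed by
`τ`, while the coefficient at the centre `1` of `J` is arbitrary. -/
theorem ncard_translate_lt {m : ℕ} (hm : 2 * m < orderOf σ)
    {J : Set Gal(K/F)} (hinv : J⁻¹ = J) (h : ∀ i ≤ m, σ ^ i ∈ J)
    (hJ : ∀ τ ∈ J, ∃ i ≤ m, τ = σ ^ i ∨ τ⁻¹ = σ ^ i) {τ : Gal(K/F)} (hτ : τ * τ = 1)
    (hτ1 : τ ≠ 1) :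
    ((supportedOn {υ | υ * τ ∈ J} ⊓ symSubmodule F K : Submodule F (Module.End F K)) :
      Set (Module.End F K)).ncard <
    ((supportedOn J ⊓ symSubmodule F K : Submodule F (Module.End F K)) :
      Set (Module.End F K)).ncard := by
  have : Finite K := Module.finite_of_finite F
  have : Finite (Module.End F K) := Module.finite_of_finite F
  have hτi : τ⁻¹ = τ := inv_eq_of_mul_eq_one_left hτ
  set A : Submodule F (Module.End F K) := supportedOn {υ | υ * τ ∈ J} ⊓ symSubmodule F K with hA
  set B : Submodule F (Module.End F K) := supportedOn J ⊓ symSubmodule F K with hB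
  let Φ : Module.End F K → Module.End F K := fun f => symMap σ m fun i => coef f (σ ^ i * τ)
  have hcoef : ∀ f, ∀ i ≤ m, coef (Φ f) (σ ^ i) = coef f (σ ^ i * τ) := fun f i hi =>
    coef_symMap hm _ hi
  have hinj : Set.InjOn Φ A := by
    intro f hf g hg e
    have hmem := Submodule.sub_mem _ hf hg
    refine sub_eq_zero.1 (eq_zero_of_half (c := 1) hmem.1 ?_ fun υ hυ => ?_)
    · rw [one_smul]
      exact hmem.2
    · have key : ∀ i ≤ m, coef (f - g) (σ ^ i * τ) = 0 := by
        intro i hi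
        rw [map_sub, Pi.sub_apply, ← hcoef f i hi, ← hcoef g i hi, e, sub_self]
      obtain ⟨i, hi, e | e⟩ := hJ _ hυ
      · left
        have : υ = σ ^ i * τ := by rw [← e, mul_assoc, hτ, mul_one]
        rw [this]
        exact key i hi
      · right
        have : υ⁻¹ = σ ^ i * τ := by
          rw [← e, mul_inv_rev, hτi, gal_mul_comm τ, mul_assoc, hτ, mul_one]
        rw [this]
        exact key i hi
  rw [← hinj.ncard_image]
  refine Set.ncard_lt_ncard ?_ (Set.toFinite _)
  rw [Set.ssubset_iff_exists]
  refine ⟨?_, ?_⟩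
  · rintro _ ⟨f, -, rfl⟩
    exact symMap_mem hinv h _
  · obtain ⟨x, hx⟩ : ∃ x, τ x ≠ x := by
      by_contra! hall
      exact hτ1 (AlgEquiv.ext hall)
    refine ⟨mono x 1, ⟨mono_mem_supportedOn _ (by simpa using h 0 (Nat.zero_le m)),
      mono_one_mem_symSubmodule x⟩, ?_⟩
    rintro ⟨f, hf, e⟩
    have h0 := hcoef f 0 (Nat.zero_le m)
    rw [e, pow_zero, one_mul, coef_mono_self] at h0
    have h1 := coef_adj f τ
    rw [mem_symSubmodule.1 hf.2, hτi, ← h0] at h1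
    exact hx h1.symm

/-! ### Codes of `q`-polynomials in terms of a generator of the Galois group -/

theorem qMonomial_eq_mono (c : K) (j : ℤ) : qMonomial c j = mono c (frob F K ^ j) := rfl

theorem orderOf_frob : orderOf (frob F K) = Module.finrank F K := by
  have : Finite K := Module.finite_of_finite F
  exact FiniteField.orderOf_frobeniusAlgEquivOfAlgebraic F K

theorem mem_zpowers_frob_zpow {n : ℕ} {s : ℤ} (hdeg : Module.finrank F K = n)
    (hs : IsCoprime s (n : ℤ)) (τ : Gal(K/F)) : τ ∈ Subgroup.zpowers (frob F K ^ s) := by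
  have : Finite K := Module.finite_of_finite F
  have h1 : frob F K ∈ Subgroup.zpowers (frob F K ^ s) := by
    rw [mem_zpowers_zpow_iff, orderOf_frob, hdeg]
    exact Int.isCoprime_iff_gcd_eq_one.1 hs
  obtain ⟨i, rfl⟩ := (FiniteField.bijective_frobeniusAlgEquivOfAlgebraic_pow F K).2 τ
  exact Subgroup.pow_mem _ h1 _

theorem orderOf_frob_zpow {n : ℕ} {s : ℤ} (hdeg : Module.finrank F K = n)
    (hs : IsCoprime s (n : ℤ)) : orderOf (frob F K ^ s) = n := by
  have : Finite K := Module.finite_of_finite F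
  rw [orderOf_eq_card_of_forall_mem_zpowers (mem_zpowers_frob_zpow hdeg hs),
    IsGalois.card_aut_eq_finrank, hdeg]

theorem qMonomial'_eq_adj {n : ℕ} {s : ℤ} (hdeg : Module.finrank F K = n) (c : K) (i : ℕ) :
    qMonomial' c (s * ((n : ℤ) - i)) = adj (mono c ((frob F K ^ s) ^ i)) := by
  have h1 : frob F K ^ (s * ((n : ℤ) - i)) = frob F K ^ (-(s * i)) := by
    rw [zpow_eq_zpow_iff_modEq, orderOf_frob, hdeg]
    exact Int.modEq_iff_dvd.2 ⟨-s, by ring⟩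
  rw [← zpow_natCast, ← zpow_mul, ← qMonomial_eq_mono, adj_qMonomial, qMonomial', qMonomial',
    powMap, h1, powMap]

theorem gabidulinShift_eq {n k : ℕ} {s : ℤ} (hdeg : Module.finrank F K = n)
    (hs : IsCoprime s (n : ℤ)) (hk : k ≤ n) (j₀ : ℕ) : gabidulinShift F K k s (s * j₀) =
      (supportedOn (interval (frob F K ^ s) j₀ k) : Submodule F (Module.End F K)) := by
  have hord := orderOf_frob_zpow hdeg hs
  have hcomp : ∀ a : ℕ → K,
      (∑ i ∈ Finset.range k, qMonomial (a i) (s * i)) ∘ₗ powMap F K (s * j₀) =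
        ∑ i ∈ Finset.range k, mono (a i) ((frob F K ^ s) ^ ((j₀ : ℤ) + i)) := by
    intro a
    ext x
    simp only [LinearMap.comp_apply, LinearMap.sum_apply, qMonomial_eq_mono, mono_apply, powMap,
      AlgEquiv.toLinearMap_apply, ← AlgEquiv.mul_apply, ← zpow_add, ← zpow_mul, mul_add]
    simp only [add_comm]
  ext f
  constructor
  · rintro ⟨_, ⟨a, rfl⟩, rfl⟩
    simp only [hcomp]
    exact Submodule.sum_mem _ fun i hi =>
      mono_mem_supportedOn _ ⟨i, Finset.mem_range.1 hi, rfl⟩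
  · intro hf
    have hinj : Set.InjOn (fun i : ℕ => (frob F K ^ s) ^ ((j₀ : ℤ) + i)) (Finset.range k) := by
      intro i hi j hj h
      have hi' := Finset.mem_range.1 hi
      have hj' := Finset.mem_range.1 hj
      have := eq_of_zpow_eq_zpow h (by omega) (by omega)
      omega
    refine ⟨_, ⟨fun i => coef f ((frob F K ^ s) ^ ((j₀ : ℤ) + i)), rfl⟩, ?_⟩
    simp only [hcomp]
    exact (eq_sum_mono hinj (by simpa [interval] using hf)).symm

theorem symCode_eq {n d : ℕ} {s : ℤ} (hdeg : Module.finrank F K = n) :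
    symCode F K n d s = {f | ∃ b, f = symMap (frob F K ^ s) ((n - d) / 2) b} := by
  have hb : ∀ b : ℕ → K, LinearMap.mulLeft F (b 0) + ∑ i ∈ Finset.Icc 1 ((n - d) / 2),
      (qMonomial (b i) (s * i) + qMonomial' (b i) (s * ((n : ℤ) - i))) =
        symMap (frob F K ^ s) ((n - d) / 2) b := by
    intro b
    rw [symMap, pairSum]
    congr 1
    refine Finset.sum_congr rfl fun i _ => ?_
    rw [qMonomial'_eq_adj hdeg, qMonomial_eq_mono, zpow_mul, zpow_natCast, one_smul]
  simp only [symCode, hb]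

theorem altCode_eq {n d : ℕ} {s : ℤ} (hdeg : Module.finrank F K = n) :
    altCode F K n d s =
      {f | ∃ b, f = pairSum (frob F K ^ s) (-1) (d / 2) ((n - 1) / 2) b} := by
  have hb : ∀ b : ℕ → K, ∑ i ∈ Finset.Icc (d / 2) ((n - 1) / 2),
      (qMonomial (b i) (s * i) - qMonomial' (b i) (s * ((n : ℤ) - i))) =
        pairSum (frob F K ^ s) (-1) (d / 2) ((n - 1) / 2) b := by
    intro b
    rw [pairSum]
    refine Finset.sum_congr rfl fun i _ => ?_
    rw [qMonomial'_eq_adj hdeg, qMonomial_eq_mono, zpow_mul, zpow_natCast, neg_one_smul_end,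
      sub_eq_add_neg]
  simp only [altCode, hb]

/-! ### The supports of the codes -/

variable {n d : ℕ}

theorem zpow_add_orderOf (hn : orderOf σ = n) (a : ℤ) : σ ^ (n + a) = σ ^ a := by
  rw [zpow_add, zpow_natCast, ← hn, pow_orderOf_eq_one, one_mul]

theorem coe_eq_of_subset {D : AddSubgroup (Module.End F K)} {C : Submodule F (Module.End F K)}
    (hDC : (D : Set (Module.End F K)) ⊆ C) (hcard : Nat.card C ≤ Nat.card D) :
    (D : Set (Module.End F K)) = C := by
  have : Finite (Module.End F K) := Module.finite_of_finite F
  refine Set.eq_of_subset_of_ncard_le hDC ?_ (Set.toFinite _)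
  rwa [← Nat.card_coe_set_eq, ← Nat.card_coe_set_eq]

/-- The support of the self-adjoint codes is `{σ ^ i | -m ≤ i ≤ m}` with `m = (n - d) / 2`. -/
theorem interval_sym (hn : orderOf σ = n) (hdn : d < n) (heven : Even (n - d)) :
    (interval σ ((n + d) / 2 : ℕ) (n - d + 1))⁻¹ = interval σ ((n + d) / 2 : ℕ) (n - d + 1) ∧
    (∀ i ≤ (n - d) / 2, σ ^ i ∈ interval σ ((n + d) / 2 : ℕ) (n - d + 1)) ∧
    ∀ τ ∈ interval σ ((n + d) / 2 : ℕ) (n - d + 1),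
      ∃ i ≤ (n - d) / 2, τ = σ ^ i ∨ τ⁻¹ = σ ^ i := by
  obtain ⟨m, hm⟩ := heven
  refine ⟨interval_inv ⟨2, by omega⟩, fun i hi => ?_, ?_⟩
  · rw [← zpow_natCast, ← zpow_add_orderOf hn]
    exact zpow_mem_interval (by omega) (by omega)
  · rintro _ ⟨i, hi, rfl⟩
    rcases le_or_gt m i with h | h
    · refine ⟨i - m, by omega, Or.inl ?_⟩
      rw [← zpow_natCast, ← zpow_add_orderOf hn ((i - m : ℕ) : ℤ)]
      congr 1
      omega
    · refine ⟨m - i, by omega, Or.inr ?_⟩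
      rw [← zpow_neg, ← zpow_natCast, ← zpow_add_orderOf hn]
      congr 1
      omega

/-- The support of the alternating codes is `{σ ^ i | d / 2 ≤ i ≤ n - d / 2}`. -/
theorem interval_alt (hn : orderOf σ = n) (hdn : d < n) (hodd : Odd n) (hd : Even d) :
    (interval σ (d / 2 : ℕ) (n - d + 1))⁻¹ = interval σ (d / 2 : ℕ) (n - d + 1) ∧
    (∀ i, d / 2 ≤ i → i ≤ (n - 1) / 2 → σ ^ i ∈ interval σ (d / 2 : ℕ) (n - d + 1)) ∧
    ∀ τ ∈ interval σ (d / 2 : ℕ) (n - d + 1),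
      ∃ i, d / 2 ≤ i ∧ i ≤ (n - 1) / 2 ∧ (τ = σ ^ i ∨ τ⁻¹ = σ ^ i) := by
  obtain ⟨m, hm⟩ := hodd
  obtain ⟨e, he⟩ := hd
  refine ⟨interval_inv ⟨1, by omega⟩, fun i h1 h2 => ?_, ?_⟩
  · rw [← zpow_natCast]
    exact zpow_mem_interval (by omega) (by omega)
  · rintro _ ⟨i, hi, rfl⟩
    rcases le_or_gt (e + i) m with h | h
    · refine ⟨e + i, by omega, by omega, Or.inl ?_⟩
      rw [← zpow_natCast]
      congr 1
      omega
    · refine ⟨n - (e + i), by omega, by omega, Or.inr ?_⟩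
      rw [← zpow_neg, ← zpow_natCast, ← zpow_add_orderOf hn]
      congr 1
      omega

end RankCodes

end

theorem mainTheorem4 {F K : Type*} [Field F] [Fintype F] [Field K] [Algebra F K]
    [FiniteDimensional F K] (n d : ℕ) (s : ℤ) (hdeg : Module.finrank F K = n) (hn : 4 ≤ n)
    (hs : IsCoprime s (n : ℤ)) (hd : 1 ≤ d) (hdn : d ≤ n - 1) :
    (Even (n - d) → ∀ D : AddSubgroup (Module.End F K),
      RankCodes.IsMaximumCode (RankCodes.symSpace F K) d D →
      (RankCodes.EquivalentIn (RankCodes.symSpace F K) (RankCodes.symCode F K n d s) D ↔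
        ∃! V : Submodule F (Module.End F K),
          RankCodes.Equivalent
            (RankCodes.gabidulinShift F K (n - d + 1) s (s * ((n + d) / 2 : ℕ))) V ∧
          (V : Set (Module.End F K)) = RankCodes.adj '' (V : Set (Module.End F K)) ∧
          (V : Set (Module.End F K)) ∩ RankCodes.symSpace F K = D)) ∧
    (Odd n → Even d → d ≠ 2 → ∀ D : AddSubgroup (Module.End F K),
      RankCodes.IsMaximumCode (RankCodes.altSpace F K) d D →
      (RankCodes.EquivalentIn (RankCodes.altSpace F K) (RankCodes.altCode F K n d s) D ↔
        ∃! V : Submodule F (Module.End F K),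
          RankCodes.Equivalent
            (RankCodes.gabidulinShift F K (n - d + 1) s (s * (d / 2 : ℕ))) V ∧
          (V : Set (Module.End F K)) = RankCodes.adj '' (V : Set (Module.End F K)) ∧
          (V : Set (Module.End F K)) ∩ RankCodes.altSpace F K = D)) := by
  open RankCodes in
  have hord : orderOf (frob F K ^ s) = n := orderOf_frob_zpow hdeg hs
  have hgen := mem_zpowers_frob_zpow (F := F) (K := K) hdeg hs
  set σ := frob F K ^ s with hσ
  have : Finite (Module.End F K) := Module.finite_of_finite F
  constructor
  · intro heven D hD
    rw [gabidulinShift_eq hdeg hs (by omega), ← hσ, symCode_eq hdeg, ← hσ]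
    obtain ⟨hinv, hmem, hhalf⟩ := interval_sym hord (by omega) heven
    set J := interval σ ((n + d) / 2 : ℕ) (n - d + 1) with hJ
    have hcode : {f : Module.End F K | ∃ b, f = symMap σ ((n - d) / 2) b} =
        (supportedOn J ⊓ symSubmodule F K : Submodule F (Module.End F K)) :=
      Set.ext fun f =>
        (mem_supportedOn_inf_symSubmodule_iff (by omega) hinv hmem hhalf).symm
    -- the standard code is a `d`-code, so `D` is at least as large
    have hcard : Nat.card (supportedOn J ⊓ symSubmodule F K : Submodule F (Module.End F K)) ≤
        Nat.card D := by
      refine hD.2.2 (supportedOn J ⊓ symSubmodule F K).toAddSubgroup (fun f hf => hf.2) ?_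
      intro f hf g hg hne
      have hfg : f - g ∈ supportedOn J ⊓ symSubmodule F K := Submodule.sub_mem _ hf hg
      have := le_rk_of_mem_supportedOn_interval hgen (by omega) hfg.1 (sub_ne_zero.2 hne)
      omega
    rw [hcode, ← coe_symSubmodule]
    refine ⟨existsUnique_of_equivalentIn hinv sandwich_mem_symSubmodule twist_mem_symSubmodule
      fun h₁ h₂ h => sandwich_supportedOn_le_of_sym h₁ h₂ (fun b => h _ ⟨?_, ?_⟩)
        fun t ht b => h _ ⟨?_, add_adj_mem_symSubmodule _⟩, ?_⟩
    · exact mono_mem_supportedOn b (by simpa using hmem 0 (Nat.zero_le _))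
    · exact mono_one_mem_symSubmodule b
    · have := adj_mem_supportedOn (mono_mem_supportedOn b ht)
      rw [hinv] at this
      exact Submodule.add_mem _ (mono_mem_supportedOn b ht) this
    · rintro ⟨V, ⟨hV, hVadj, hVD⟩, -⟩
      rcases Nat.lt_or_ge 1 d with hd2 | hd1
      · refine equivalentIn_of_exists hinv (eq_one_of_mul_mem_interval hgen (by omega) (by omega))
          sandwich_mem_symSubmodule twist_mem_symSubmodule (fun g τ hτ e => ?_) hV hVadj hVD
        by_contra hτ1
        have hlt := ncard_translate_lt (m := (n - d) / 2) (by omega) hinv hmem hhalf hτ hτ1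
        refine absurd hcard (not_le.2 ?_)
        rw [← SetLike.coe_sort_coe, ← SetLike.coe_sort_coe, Nat.card_coe_set_eq,
          Nat.card_coe_set_eq, e, Submodule.map_coe, LinearEquiv.coe_coe,
          Set.ncard_image_of_injective _ (LinearEquiv.injective _)]
        exact hlt
      · -- for `d = 1` the support is the whole Galois group and `D` consists of all
        -- self-adjoint maps
        have huniv : ∀ τ, τ ∈ J := by
          intro τ
          obtain ⟨a, h1, h2, rfl⟩ := exists_zpow_eq hgen τ ((n + d) / 2 : ℕ)
          exact zpow_mem_interval h1 (by omega)
        have hDC := coe_eq_of_subset (C := supportedOn J ⊓ symSubmodule F K)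
          (fun f hf => ⟨fun τ hτ => absurd (huniv τ) hτ, hD.1 hf⟩) hcard
        rw [equivalentIn_iff (C := supportedOn J ⊓ symSubmodule F K) fun ρ f hf =>
          ⟨twist_mem_supportedOn ρ hf.1, twist_mem_symSubmodule ρ f hf.2⟩]
        refine ⟨LinearEquiv.refl F K, ?_⟩
        have hid : ∀ f : Module.End F K,
            sandwich (LinearEquiv.refl F K) (adjEquiv (LinearEquiv.refl F K)) f = f := by
          intro f
          rw [sandwich_apply, adjEquiv_toLinearMap, LinearEquiv.refl_toLinearMap, adj_id]
          rfl
        rw [hDC]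
        ext f
        simp [hid]
  · intro hodd hdeven hd2 D hD
    have hd4 : 4 ≤ d := by
      obtain ⟨e, rfl⟩ := hdeven
      omega
    rw [gabidulinShift_eq hdeg hs (by omega), ← hσ, altCode_eq hdeg, ← hσ]
    obtain ⟨hinv, hmem, hhalf⟩ := interval_alt hord (by omega) hodd hdeven
    have hz := exists_notMem_interval hord hgen hodd hdeven hd4 (by omega)
    have h1 : (1 : Gal(K/F)) ∉ interval σ (d / 2 : ℕ) (n - d + 1) := by
      rw [← zpow_zero σ, ← zpow_add_orderOf hord, zpow_mem_interval_iff (by omega) (by omega)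
        (by omega)]
      omega
    set J := interval σ (d / 2 : ℕ) (n - d + 1) with hJ
    have hcode : {f : Module.End F K | ∃ b, f = pairSum σ (-1) (d / 2) ((n - 1) / 2) b} =
        (supportedOn J ⊓ altSubmodule F K : Submodule F (Module.End F K)) :=
      Set.ext fun f =>
        (mem_supportedOn_inf_altSubmodule_iff (by omega) (by omega) hinv hmem hhalf).symm
    rw [hcode, ← coe_altSubmodule]
    refine ⟨existsUnique_of_equivalentIn hinv sandwich_mem_altSubmodule twist_mem_altSubmodule
      fun h₁ h₂ h => sandwich_supportedOn_le_of_alt h₁ h₂ h1 hz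
        fun t ht b => h _ ⟨?_, sub_adj_mem_altSubmodule _⟩, ?_⟩
    · have := adj_mem_supportedOn (mono_mem_supportedOn b ht)
      rw [hinv] at this
      exact Submodule.sub_mem _ (mono_mem_supportedOn b ht) this
    · rintro ⟨V, ⟨hV, hVadj, hVD⟩, -⟩
      refine equivalentIn_of_exists hinv (eq_one_of_mul_mem_interval hgen (by omega) (by omega))
        sandwich_mem_altSubmodule twist_mem_altSubmodule (fun g τ hτ _ => ?_) hV hVadj hVD
      -- the Galois group has odd order, so it contains no involution
      have hdvd : orderOf τ ∣ n := by
        rw [← hord, orderOf_eq_card_of_forall_mem_zpowers hgen]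
        exact orderOf_dvd_natCard τ
      have h2 : orderOf τ ∣ 2 := orderOf_dvd_of_pow_eq_one (by rw [pow_two, hτ])
      have hcop : Nat.Coprime n 2 := Nat.coprime_two_right.2 hodd
      exact orderOf_eq_one_iff.1 (Nat.eq_one_of_dvd_coprimes hcop hdvd h2)
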